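/- **Proposition (Fixed-time estimate).** Let $1/2<s<1$. Write $\hat u(\xi)=\int_{\mathbb R^2}e^{-ix\cdot\xi}u(x)\,dx$ and $\|f\|_{H^1}=\|\langle\xi\rangle\hat f\|_{L^2(\mathbb R^2)}$, where $\langle\xi\rangle=(1+|\xi|^2)^{1/2}$. For every $N\ge 1$ let $m=m_N$ be a smooth radial function on $\mathbb R^2$, written $m(\xi)=m(|\xi|)$, with $m(\xi)=1$ for $|\xi|\le N$ and $m(\xi)=(|\xi|/N)^{s-1}$ for $|\xi|\ge 2N$, which interpolates smoothly in between, uniformly in $N$: for $N\le r\le 2N$ one has $2^{s-1}\le m_N(r)\le 1$, and for each $k$ there is $B_k$, independent of $N$, with $|\partial_r^k m_N(r)|\le B_kN^{-k}$. Let $I=I_N$ be the Fourier multiplier $\widehat{Iu}=m\,\hat u$. Let $\Sigma_k=\{(\xi_1,\dots,\xi_k)\in(\mathbb R^2)^k:\xi_1+\dots+\xi_k=0\}$, with the push-forward of Lebesgue measure $d\xi_1\cdots d\xi_{k-1}$ under $(\xi_1,\dots,\xi_{k-1})\mapsto(\xi_1,\dots,\xi_{k-1},-\xi_1-\dots-\xi_{k-1})$,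 and for a symbol $M:\Sigma_4\to\mathbb C$ set $$\Lambda_4(M;u)=\frac1{(2\pi)^6}\,\mathrm{Re}\int_{\Sigma_4}M(\xi_1,\xi_2,\xi_3,\xi_4)\,\hat u(\xi_1)\,\hat{\bar u}(\xi_2)\,\hat u(\xi_3)\,\hat{\bar u}(\xi_4).$$ Let $[M]_{\mathrm{sym}}=\frac18\sum_{g\in G_4}gM$, where $G_4$ is the group of order $8$ acting on symbols that is generated by the permutations of $\xi_1,\xi_3$, the permutations of $\xi_2,\xi_4$, and $M(\xi_1,\xi_2,\xi_3,\xi_4)\mapsto\overline{M}(\xi_2,\xi_1,\xi_4,\xi_3)$. With $m_j=m(\xi_j)$ and $\xi_{ab}=\xi_a+\xi_b$, put $$\sigma_2(\xi_1,\xi_2)=-\tfrac12 m_1\xi_1\cdot m_2\xi_2,\qquad X(\sigma_2)(\xi_1,\xi_2,\xi_3,\xi_4)=\sigma_2(\xi_1+\xi_2+\xi_3,\xi_4),$$ $$\sigma_4=\tfrac14m_1m_2m_3m_4,\qquad \alpha_4=-|\xi_1|^2+|\xi_2|^2-|\xi_3|^2+|\xi_4|^2,$$ and for $0<\theta_0<1/100$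 $$\Omega_{nr}=\Big\{\xi\in\Sigma_4:\max_{1\le j\le4}|\xi_j|\le N\Big\}\cup\big\{\xi\in\Sigma_4:|\cos\angle(\xi_{12},\xi_{14})|\ge\theta_0\big\},\qquad \tilde\sigma_4=\frac{[2iX(\sigma_2)]_{\mathrm{sym}}}{i\alpha_4}\,1_{\Omega_{nr}}$$ (the null sets where $\alpha_4=0$ or the angle is undefined are irrelevant). Then for every $\varepsilon>0$ there is a constant $C$, depending only on $s$, $\varepsilon$ and the choice of the family $(m_N)_{N\ge1}$, such that for all $N\ge1$, all $0<\theta_0<1/100$ and all Schwartz functions $u:\mathbb R^2\to\mathbb C$, the integral defining $\Lambda_4(\sigma_4-\tilde\sigma_4;u)$ converges absolutely and $$|\Lambda_4(\sigma_4-\tilde\sigma_4;u)|\le C\,\theta_0^{-1}N^{-2+\varepsilon}\,\|Iu\|_{H^1(\mathbb R^2)}^4 .$$ -/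

import Mathlib

namespace IMethod

open MeasureTheory

noncomputable section

/-- The plane `ℝ²` with its Euclidean norm and Lebesgue measure. -/
abbrev Plane : Type := EuclideanSpace ℝ (Fin 2)

/-- The Fourier transform `û(ξ) = ∫ e^{-i x·ξ} u(x) dx`. -/
def hat (u : Plane → ℂ) (ξ : Plane) : ℂ :=
  ∫ x : Plane, Complex.exp (-(Complex.I * ((inner ℝ x ξ : ℝ) : ℂ))) * u x

/-- The inverse Fourier transform `(2π)⁻² ∫ e^{i x·ξ} g(ξ) dξ`. -/
def invHat (g : Plane → ℂ) (x : Plane) : ℂ :=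
  (((2 * Real.pi) ^ 2 : ℝ) : ℂ)⁻¹ *
    ∫ ξ : Plane, Complex.exp (Complex.I * ((inner ℝ x ξ : ℝ) : ℂ)) * g ξ

/-- The Sobolev norm `‖f‖_{H^σ} = ‖⟨ξ⟩^σ f̂(ξ)‖_{L²}`, where `⟨ξ⟩ = (1 + |ξ|²)^{1/2}`. -/
def sobolevNorm (σ : ℝ) (f : Plane → ℂ) : ℝ :=
  (eLpNorm (fun ξ : Plane => ((Real.sqrt (1 + ‖ξ‖ ^ 2) ^ σ : ℝ) : ℂ) * hat f ξ) 2 volume).toReal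

/-- `m N` is, for each `N ≥ 1`, the radial profile `r = |ξ| ↦ m(r)` of the symbol of the operator
`I = I_N` of order `s`: smooth, equal to `1` for `r ≤ N`, equal to `(r / N)^(s - 1)` for
`r ≥ 2 N`. In the transition region the values stay between the two end values `1` and
`2 ^ (s - 1)` (as they do when `m N` is nonincreasing), and the interpolation is smooth at scale
`N`, uniformly in `N`. (The values at `r < 0` play no role.) -/
structure IsIMultiplier (s : ℝ) (m : ℝ → ℝ → ℝ) : Prop where
  smooth : ∀ N : ℝ, 1 ≤ N → ContDiff ℝ ((⊤ : ℕ∞) : WithTop ℕ∞) (m N)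
  low : ∀ N : ℝ, 1 ≤ N → ∀ r : ℝ, r ≤ N → m N r = 1
  high : ∀ N : ℝ, 1 ≤ N → ∀ r : ℝ, 2 * N ≤ r → m N r = (r / N) ^ (s - 1)
  between : ∀ N : ℝ, 1 ≤ N → ∀ r : ℝ, N ≤ r → r ≤ 2 * N →
    (2 : ℝ) ^ (s - 1) ≤ m N r ∧ m N r ≤ 1
  deriv_bound : ∀ k : ℕ, ∃ B : ℝ, ∀ N : ℝ, 1 ≤ N → ∀ r : ℝ, N ≤ r → r ≤ 2 * N →
    |iteratedDeriv k (m N) r| ≤ B / N ^ k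

/-- The Fourier multiplier with symbol `ξ ↦ ρ(|ξ|)`; `I_N u` is `multiplierOp (m N) u`. -/
def multiplierOp (ρ : ℝ → ℝ) (u : Plane → ℂ) : Plane → ℂ :=
  invHat fun ξ => (ρ ‖ξ‖ : ℂ) * hat u ξ

/-! ### Multilinear forms -/

/-- The hyperplane `Σ_k = {ξ₁ + ⋯ + ξ_k = 0}`. -/
def sigmaSet (k : ℕ) : Set (Fin k → Plane) := {ξ | ∑ j, ξ j = 0}

/-- The parametrization `(ξ₁, …, ξ_n) ↦ (ξ₁, …, ξ_n, -ξ₁ - ⋯ - ξ_n)` of `Σ_{n+1}`. -/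
def sigmaParam (n : ℕ) (η : Fin n → Plane) : Fin (n + 1) → Plane :=
  Fin.snoc (α := fun _ => Plane) η (-∑ j, η j)

/-- The measure of `Σ_{n+1}`, as a measure on `(ℝ²)^{n+1}` carried by `Σ_{n+1}`: the push-forward
of Lebesgue measure `dξ₁ ⋯ dξ_n`. -/
def sigmaMeasure (n : ℕ) : Measure (Fin (n + 1) → Plane) :=
  Measure.map (sigmaParam n) volume

/-- The integrand `M(ξ₁, …, ξ_k) û₁(ξ₁) ⋯ û_k(ξ_k)`. -/
def lambdaIntegrand {k : ℕ} (M : (Fin k → Plane) → ℂ) (u : Fin k → Plane → ℂ)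
    (ξ : Fin k → Plane) : ℂ :=
  M ξ * ∏ j, hat (u j) (ξ j)

/-- `Λ_k(M; u₁, …, u_k)` with `k = n + 1`. -/
def Lambda {n : ℕ} (M : (Fin (n + 1) → Plane) → ℂ) (u : Fin (n + 1) → Plane → ℂ) : ℝ :=
  1 / (2 * Real.pi) ^ (2 * n) * (∫ ξ, lambdaIntegrand M u ξ ∂(sigmaMeasure n)).re

/-- The arguments `(u, ū, u, ū, …)` (the index `j` stands for the slot `j + 1`). -/
def alternating {k : ℕ} (u : Plane → ℂ) (j : Fin k) : Plane → ℂ :=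
  if (j : ℕ) % 2 = 0 then u else fun x => (starRingEnd ℂ) (u x)

/-- The permutation preserves the parity of every index. -/
def ParityPreserving {k : ℕ} (g : Equiv.Perm (Fin k)) : Prop :=
  ∀ j, (g j : ℕ) % 2 = (j : ℕ) % 2

/-- The permutation reverses the parity of every index. -/
def ParityReversing {k : ℕ} (g : Equiv.Perm (Fin k)) : Prop :=
  ∀ j, (g j : ℕ) % 2 ≠ (j : ℕ) % 2

open Classical in
/-- The group `G_k` (`k ≥ 2` even): generated by the permutations of the odd arguments, those of
the even arguments, and the swap of the odd with the even arguments. -/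
def symGroup (k : ℕ) : Finset (Equiv.Perm (Fin k)) :=
  Finset.univ.filter fun g => ParityPreserving g ∨ ParityReversing g

open Classical in
/-- The action on symbols; the elements that swap odd with even arguments also conjugate. -/
def symAct {k : ℕ} (g : Equiv.Perm (Fin k)) (M : (Fin k → Plane) → ℂ) (ξ : Fin k → Plane) : ℂ :=
  if ParityPreserving g then M (fun j => ξ (g j)) else (starRingEnd ℂ) (M fun j => ξ (g j))

/-- The symmetric component `[M]_sym = |G_k|⁻¹ ∑_{g ∈ G_k} g M`. -/
def symmetrize {k : ℕ} (M : (Fin k → Plane) → ℂ) (ξ : Fin k → Plane) : ℂ :=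
  ((symGroup k).card : ℂ)⁻¹ * ∑ g ∈ symGroup k, symAct g M ξ

/-- The extended symbol `X(M)(ξ₁, …, ξ_{k+2}) = M(ξ₁ + ξ₂ + ξ₃, ξ₄, …, ξ_{k+2})`, `k = n + 1`. -/
def extendSymbol {n : ℕ} (M : (Fin (n + 1) → Plane) → ℂ) (ξ : Fin (n + 3) → Plane) : ℂ :=
  M (Fin.cons (α := fun _ => Plane) (ξ 0 + ξ 1 + ξ 2) fun j : Fin n => ξ j.succ.succ.succ)

/-! ### The symbols -/

/-- `σ₂(ξ₁, ξ₂) = -½ m(ξ₁) ξ₁ · m(ξ₂) ξ₂`. -/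
def sigma2 (ρ : ℝ → ℝ) (ξ : Fin 2 → Plane) : ℂ :=
  ((-(1 / 2) * inner ℝ (ρ ‖ξ 0‖ • ξ 0) (ρ ‖ξ 1‖ • ξ 1) : ℝ) : ℂ)

/-- `σ₄ = ¼ m(ξ₁) m(ξ₂) m(ξ₃) m(ξ₄)`. -/
def sigma4 (ρ : ℝ → ℝ) (ξ : Fin 4 → Plane) : ℂ :=
  ((1 / 4 * ∏ j, ρ ‖ξ j‖ : ℝ) : ℂ)

/-- `α₄ = -|ξ₁|² + |ξ₂|² - |ξ₃|² + |ξ₄|²`. -/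
def alpha4 (ξ : Fin 4 → Plane) : ℝ :=
  -‖ξ 0‖ ^ 2 + ‖ξ 1‖ ^ 2 - ‖ξ 2‖ ^ 2 + ‖ξ 3‖ ^ 2

/-- The non-resonant set `Ω_nr`. The angle is given a conventional value on the null set where one
of the two vectors vanishes. -/
def nonResonant (N θ₀ : ℝ) : Set (Fin 4 → Plane) :=
  {ξ | ξ ∈ sigmaSet 4 ∧ ∀ j, ‖ξ j‖ ≤ N} ∪
    {ξ | ξ ∈ sigmaSet 4 ∧
      θ₀ ≤ |Real.cos (InnerProductGeometry.angle (ξ 0 + ξ 1) (ξ 0 + ξ 3))|}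

/-- `σ̃₄ = [2 i X(σ₂)]_sym / (i α₄) · 1_{Ω_nr}` (the quotient is `0` on the null set `α₄ = 0`). -/
def sigmaTilde4 (ρ : ℝ → ℝ) (N θ₀ : ℝ) : (Fin 4 → Plane) → ℂ :=
  (nonResonant N θ₀).indicator fun ξ =>
    symmetrize (fun ζ : Fin 4 → Plane => 2 * Complex.I * extendSymbol (sigma2 ρ) ζ) ξ /
      (Complex.I * (alpha4 ξ : ℂ))

end

end IMethod

namespace IMethod

open MeasureTheory FourierTransform Real
open scoped SchwartzMap ContDiff ENNReal

/-! Put F(ξ) = m(ξ)²|ξ|². On Σ₄ the symmetrized numerator is (i/4)(-F(ξ₁) + F(ξ₂) - F(ξ₃) + F(ξ₄)),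
while α₄ = -2 ξ₁₂·ξ₁₄. If all frequencies are at most N, then F = |ξ|², the quotient is exactly 1/4
= σ₄, and the symbol vanishes (`symbol_eq_zero`).

If some frequency exceeds N, the alternating sum is a second difference of F with steps ξ₁₂ and ξ₁₄.
The gradient of F is Lipschitz uniformly in N, so the sum is O(|ξ₁₂||ξ₁₄|), and on Ω_nr the angle
condition gives |α₄| ≥ 2θ₀|ξ₁₂||ξ₁₄|. Hence the symbol is O(θ₀⁻¹) (`symbol_bound`).

It remains to gain N^{-2+ε} from the four factors. Write |û| = m⁻¹⟨ξ⟩⁻¹W, where W has L² norm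
‖Iu‖_{H¹}. The largest frequency R > N has a partner of size at least R/3; these two factors give
R⁻², and the four factors m⁻¹ cost (R/N)^{4-4s}. Since s > 1/2, the loss is affordable
(`prod_norm_hat_le`). The two remaining factors ⟨ξ⟩⁻¹W are made integrable by giving up R^δ each,
and the integral is bounded by L²·L²·L¹·L¹ (`lintegral_sigmaMeasure_pair_le`). -/

/-! ### Fourier conventions and the operator I on Schwartz functions. -/

lemma hat_eq_fourier (u : Plane → ℂ) (ξ : Plane) : hat u ξ = 𝓕 u ((2 * π)⁻¹ • ξ) := by
  rw [Real.fourier_eq', hat]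
  congr 1 with x
  rw [smul_eq_mul, inner_smul_right]
  congr 2
  push_cast
  field_simp

lemma invHat_eq_fourierInv (g : Plane → ℂ) (x : Plane) :
    invHat g x = 𝓕⁻ (fun η => g ((2 * π) • η)) x := by
  rw [Real.fourierInv_eq', invHat]
  have h := Measure.integral_comp_smul (volume : Measure Plane)
    (fun ξ => Complex.exp (Complex.I * ((inner ℝ x ξ : ℝ) : ℂ)) * g ξ) (2 * π)
  have hd : Module.finrank ℝ Plane = 2 := by simp
  rw [hd, abs_of_pos (by positivity), Complex.real_smul, Complex.ofReal_inv] at h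
  rw [← h]
  congr 1 with y
  rw [smul_eq_mul, inner_smul_right, real_inner_comm]
  congr 2
  push_cast
  ring

lemma hat_invHat (g : 𝓢(Plane, ℂ)) : hat (invHat g) = g := by
  have hpi : (2 * π) ≠ 0 := by positivity
  let e : Plane ≃L[ℝ] Plane := ContinuousLinearEquiv.smulLeft (Units.mk0 (2 * π) hpi)
  let G : 𝓢(Plane, ℂ) := SchwartzMap.compCLMOfContinuousLinearEquiv ℂ e g
  have hG : (fun η => g ((2 * π) • η)) = G := by ext η; rfl
  ext ξ
  have h1 : invHat g = 𝓕⁻ G := by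
    ext x
    rw [invHat_eq_fourierInv, hG, SchwartzMap.fourierInv_coe]
  rw [hat_eq_fourier, h1, ← SchwartzMap.fourier_coe, FourierTransform.fourier_fourierInv_eq, ← hG]
  simp only
  rw [smul_smul, mul_inv_cancel₀ hpi, one_smul]

lemma hat_conj (u : Plane → ℂ) (ξ : Plane) :
    hat (fun x => (starRingEnd ℂ) (u x)) ξ = (starRingEnd ℂ) (hat u (-ξ)) := by
  rw [hat, hat, ← integral_conj]
  congr 1 with x
  rw [map_mul, ← Complex.exp_conj]
  simp

lemma exists_schwartzMap_eq_hat (u : 𝓢(Plane, ℂ)) : ∃ v : 𝓢(Plane, ℂ), ⇑v = hat u := by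
  have hpi : (2 * π)⁻¹ ≠ 0 := by positivity
  let e : Plane ≃L[ℝ] Plane := ContinuousLinearEquiv.smulLeft (Units.mk0 (2 * π)⁻¹ hpi)
  refine ⟨SchwartzMap.compCLMOfContinuousLinearEquiv ℂ e (𝓕 u), ?_⟩
  ext ξ
  rw [hat_eq_fourier, ← SchwartzMap.fourier_coe]
  rfl

/-- A smooth function on the line that is constant near `-∞` and a nonpositive power near `∞` has
temperate growth. -/
lemma hasTemperateGrowth_of_eventually_rpow {h : ℝ → ℝ} (hs : ContDiff ℝ ∞ h) {a b c d p : ℝ}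
    (hb : 0 < b) (hp : p ≤ 0) (hlow : ∀ t < a, h t = d)
    (hhigh : ∀ t, b < t → h t = c * t ^ p) : h.HasTemperateGrowth := by
  refine ⟨hs, fun n => ?_⟩
  obtain ⟨K, hK⟩ := (isCompact_Icc (a := a) (b := b)).exists_bound_of_continuousOn
    (hs.continuous_iteratedDeriv n (mod_cast le_top)).continuousOn
  -- Growth exponent 0: every derivative is bounded. The three terms serve the compact middle, the
  -- constant end and the power end.
  refine ⟨0, |K| + |d| + |c| * (|(descPochhammer ℝ n).eval p| * b ^ (p - n)), fun t => ?_⟩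
  rw [norm_iteratedFDeriv_eq_norm_iteratedDeriv, pow_zero, mul_one]
  have h3 : 0 ≤ |c| * (|(descPochhammer ℝ n).eval p| * b ^ (p - n)) := by positivity
  rcases lt_or_ge t a with hta | hta
  · have : h =ᶠ[nhds t] fun _ => d := by
      filter_upwards [Iio_mem_nhds hta] with x hx using hlow x hx
    rw [this.iteratedDeriv_eq, iteratedDeriv_const]
    split_ifs <;> simp <;> nlinarith [abs_nonneg K, abs_nonneg d]
  rcases le_or_gt t b with htb | htb
  · have := hK t ⟨hta, htb⟩
    nlinarith [le_abs_self K, abs_nonneg d]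
  · have : h =ᶠ[nhds t] fun x => c * x ^ p := by
      filter_upwards [Ioi_mem_nhds htb] with x hx using hhigh x hx
    rw [this.iteratedDeriv_eq, iteratedDeriv_const_mul_field, iteratedDeriv_eq_iterate,
      Real.iter_deriv_rpow_const, norm_mul, norm_mul]
    simp only [Real.norm_eq_abs]
    have hle : |t ^ (p - n)| ≤ b ^ (p - n) := by
      rw [abs_of_nonneg (by have := hb.trans htb; positivity)]
      exact Real.rpow_le_rpow_of_nonpos hb htb.le (by
        have : (0 : ℝ) ≤ n := n.cast_nonneg
        linarith)
    have : |c| * (|(descPochhammer ℝ n).eval p| * |t ^ (p - n)|) ≤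
      |c| * (|(descPochhammer ℝ n).eval p| * b ^ (p - n)) := by gcongr
    linarith [abs_nonneg K, abs_nonneg d]

/-- The norm is not smooth at 0, so the symbol is viewed as t ↦ m(√t) composed with |x|². The
singularity of √ at 0 is invisible because m = 1 there. -/
lemma IsIMultiplier.hasTemperateGrowth {s : ℝ} (hs1 : s < 1) {m : ℝ → ℝ → ℝ}
    (hm : IsIMultiplier s m) {N : ℝ} (hN : 1 ≤ N) :
    (fun x : Plane => m N ‖x‖).HasTemperateGrowth := by
  have key : (fun t : ℝ => m N (√t)).HasTemperateGrowth := by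
    refine hasTemperateGrowth_of_eventually_rpow (a := N ^ 2) (b := (2 * N) ^ 2)
      (c := (N⁻¹) ^ (s - 1)) (d := 1) (p := (s - 1) / 2) ?_ (by positivity) (by linarith) ?_ ?_
    · rw [contDiff_iff_contDiffAt]
      intro t
      rcases lt_or_ge t (N ^ 2) with ht | ht
      · refine (contDiffAt_const (c := (1 : ℝ))).congr_of_eventuallyEq ?_
        filter_upwards [Iio_mem_nhds ht] with x hx
        exact hm.low N hN _ (Real.sqrt_le_iff.2 ⟨by linarith, le_of_lt hx⟩)
      · exact (hm.smooth N hN).contDiffAt.comp t (Real.contDiffAt_sqrt (by nlinarith))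
    · intro t ht
      exact hm.low N hN _ (Real.sqrt_le_iff.2 ⟨by linarith, le_of_lt ht⟩)
    · intro t ht
      have ht0 : 0 ≤ t := le_trans (by positivity) ht.le
      rw [hm.high N hN _ (Real.le_sqrt_of_sq_le ht.le), div_eq_inv_mul,
        Real.mul_rpow (by positivity) (by positivity), Real.sqrt_eq_rpow, ← Real.rpow_mul ht0]
      congr 2
      ring
  have := key.comp (Function.hasTemperateGrowth_norm_sq Plane)
  simpa [Function.comp_def] using this

/-- Temperate growth keeps the symbol times û a Schwartz function, so Fourier inversion holds at
every point. -/
lemma hat_multiplierOp {ρ : ℝ → ℝ} (hρ : (fun x : Plane => ρ ‖x‖).HasTemperateGrowth)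
    (u : 𝓢(Plane, ℂ)) (ξ : Plane) : hat (multiplierOp ρ u) ξ = ρ ‖ξ‖ * hat u ξ := by
  obtain ⟨v, hv⟩ := exists_schwartzMap_eq_hat u
  have h : (fun ξ : Plane => (ρ ‖ξ‖ : ℂ) * hat u ξ) =
      SchwartzMap.smulLeftCLM ℂ (fun x : Plane => ρ ‖x‖) v := by
    ext ξ
    rw [SchwartzMap.smulLeftCLM_apply_apply hρ, hv]
    simp
  rw [multiplierOp, h, hat_invHat, ← h]

/-- The function `⟨ξ⟩ ρ(|ξ|) |û(ξ)|`, whose `L²` norm is the `H¹` norm of `multiplierOp ρ u`. -/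
noncomputable def weightedHat (ρ : ℝ → ℝ) (u : Plane → ℂ) (ξ : Plane) : ℝ :=
  √(1 + ‖ξ‖ ^ 2) * |ρ ‖ξ‖| * ‖hat u ξ‖

lemma lintegral_weightedHat_sq {ρ : ℝ → ℝ}
    (hρ : (fun x : Plane => ρ ‖x‖).HasTemperateGrowth) (u : 𝓢(Plane, ℂ)) :
    ∫⁻ ξ, ENNReal.ofReal (weightedHat ρ u ξ) ^ 2 =
      ENNReal.ofReal (sobolevNorm 1 (multiplierOp ρ u)) ^ 2 := by
  obtain ⟨v, hv⟩ := exists_schwartzMap_eq_hat u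
  have hw : (fun x : Plane => (1 + ‖x‖ ^ 2) ^ (1 / 2 : ℝ) * ρ ‖x‖).HasTemperateGrowth :=
    (Function.hasTemperateGrowth_one_add_norm_sq_rpow Plane _).mul hρ
  have h : (fun ξ : Plane => ((√(1 + ‖ξ‖ ^ 2) ^ (1 : ℝ) : ℝ) : ℂ) * hat (multiplierOp ρ u) ξ) =
      SchwartzMap.smulLeftCLM ℂ (fun x : Plane => (1 + ‖x‖ ^ 2) ^ (1 / 2 : ℝ) * ρ ‖x‖) v := by
    ext ξ
    rw [SchwartzMap.smulLeftCLM_apply_apply hw, hv, hat_multiplierOp hρ, Real.rpow_one,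
      Real.sqrt_eq_rpow]
    simp [mul_assoc]
  -- Finiteness matters: `toReal` in `sobolevNorm` would turn an infinite norm into 0.
  have hfin := SchwartzMap.eLpNorm_lt_top
    (SchwartzMap.smulLeftCLM ℂ (fun x : Plane => (1 + ‖x‖ ^ 2) ^ (1 / 2 : ℝ) * ρ ‖x‖) v) 2
  rw [← h] at hfin
  rw [sobolevNorm, ENNReal.ofReal_toReal hfin.ne]
  have := eLpNorm_nnreal_pow_eq_lintegral (p := 2) (μ := (volume : Measure Plane)) (f := fun ξ : Plane =>
    ((√(1 + ‖ξ‖ ^ 2) ^ (1 : ℝ) : ℝ) : ℂ) * hat (multiplierOp ρ u) ξ) two_ne_zero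
  norm_num at this
  norm_num
  rw [this]
  congr 1 with ξ
  congr 1
  rw [hat_multiplierOp hρ, weightedHat, ← ofReal_norm]
  simp only [Complex.norm_real, Real.norm_eq_abs, abs_of_nonneg (Real.sqrt_nonneg _), enorm_mul,
    ENNReal.ofReal_mul', norm_nonneg, mul_assoc, ofReal_norm, ENNReal.ofReal_mul,
    Real.sqrt_nonneg]
  rw [← ofReal_norm (ρ ‖ξ‖ : ℂ), Complex.norm_real, Real.norm_eq_abs]

/-! ### Bounds on m, uniform in N. -/

section Multiplier

variable {s : ℝ} {m : ℝ → ℝ → ℝ} {N : ℝ}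

lemma IsIMultiplier.pos (hm : IsIMultiplier s m) (hN : 1 ≤ N) (r : ℝ) : 0 < m N r := by
  rcases le_total r N with h | h
  · rw [hm.low N hN r h]; exact one_pos
  rcases le_total r (2 * N) with h2 | h2
  · exact lt_of_lt_of_le (by positivity) (hm.between N hN r h h2).1
  · rw [hm.high N hN r h2]
    have : 0 < r / N := div_pos (by linarith) (by linarith)
    positivity

lemma IsIMultiplier.le_one (hs1 : s < 1) (hm : IsIMultiplier s m) (hN : 1 ≤ N) (r : ℝ) :
    m N r ≤ 1 := by
  rcases le_total r N with h | h
  · rw [hm.low N hN r h]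
  rcases le_total r (2 * N) with h2 | h2
  · exact (hm.between N hN r h h2).2
  · rw [hm.high N hN r h2]
    exact Real.rpow_le_one_of_one_le_of_nonpos ((one_le_div₀ (by linarith)).2 h) (by linarith)

/-- No monotonicity of m is available in the transition region; the factor 2 absorbs it, since
2^{s-1} ≥ 1/2. -/
lemma IsIMultiplier.inv_le (hs : 0 < s) (hs1 : s < 1) (hm : IsIMultiplier s m) (hN : 1 ≤ N)
    {r R : ℝ} (hr : r ≤ R) (hR : N ≤ R) : (m N r)⁻¹ ≤ 2 * (R / N) ^ (1 - s) := by
  have hN0 : 0 < N := by linarith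
  have hRN : 1 ≤ R / N := (one_le_div₀ hN0).2 hR
  have h1 : 1 ≤ (R / N) ^ (1 - s) := Real.one_le_rpow hRN (by linarith)
  rcases le_total r N with h | h
  · rw [hm.low N hN r h, inv_one]; linarith
  rcases le_total r (2 * N) with h2 | h2
  · have h3 := (hm.between N hN r h h2).1
    have h4 : (2 : ℝ) ^ (-1 : ℝ) ≤ 2 ^ (s - 1) :=
      Real.rpow_le_rpow_of_exponent_le (by norm_num) (by linarith)
    rw [Real.rpow_neg_one] at h4
    calc (m N r)⁻¹ ≤ ((2 : ℝ)⁻¹)⁻¹ := inv_anti₀ (by norm_num) (h4.trans h3)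
      _ ≤ _ := by rw [inv_inv]; linarith
  · rw [hm.high N hN r h2, ← Real.rpow_neg (div_nonneg (by linarith) hN0.le), neg_sub]
    have : (r / N) ^ (1 - s) ≤ (R / N) ^ (1 - s) :=
      Real.rpow_le_rpow (div_nonneg (by linarith) hN0.le) (by gcongr) (by linarith)
    linarith

/-- The scale-invariant form of the derivative bounds: r ≤ 2N offsets N⁻ⁿ in the transition region,
and on the power part rⁿ times the n-th derivative is a constant multiple of m ≤ 1. -/
lemma IsIMultiplier.pow_mul_iteratedDeriv_bound (hs1 : s < 1) (hm : IsIMultiplier s m) (n : ℕ) :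
    ∃ B : ℝ, 0 ≤ B ∧ ∀ N : ℝ, 1 ≤ N → ∀ r : ℝ, 0 < r →
      |r ^ n * iteratedDeriv n (m N) r| ≤ B := by
  obtain ⟨B, hB⟩ := hm.deriv_bound n
  refine ⟨2 ^ n * |B| + |(descPochhammer ℝ n).eval (s - 1)| + 1, by positivity,
    fun N hN r hr => ?_⟩
  have hN0 : 0 < N := by linarith
  have h1 : 0 ≤ 2 ^ n * |B| := by positivity
  have h2 := abs_nonneg ((descPochhammer ℝ n).eval (s - 1))
  rcases lt_or_ge r N with h | h
  · have : m N =ᶠ[nhds r] fun _ => 1 := by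
      filter_upwards [Iio_mem_nhds h] with x hx using hm.low N hN x (le_of_lt hx)
    rw [this.iteratedDeriv_eq, iteratedDeriv_const]
    split_ifs with h0
    · simp only [h0, pow_zero, one_mul, abs_one]
      rw [h0] at h1 h2
      simp only [pow_zero, one_mul] at h1
      linarith
    · simp only [mul_zero, abs_zero]; linarith
  rcases le_or_gt r (2 * N) with h3 | h3
  · have h4 := hB N hN r h h3
    rw [abs_mul, abs_of_pos (by positivity)]
    calc r ^ n * |iteratedDeriv n (m N) r| ≤ (2 * N) ^ n * (|B| / N ^ n) := by
          gcongr
          exact h4.trans (by gcongr; exact le_abs_self B)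
      _ = 2 ^ n * |B| := by rw [mul_pow]; field_simp
      _ ≤ _ := by linarith
  · have : m N =ᶠ[nhds r] fun x => (N⁻¹) ^ (s - 1) * x ^ (s - 1) := by
      filter_upwards [Ioi_mem_nhds h3, Ioi_mem_nhds hr] with x hx hx0
      rw [hm.high N hN x (le_of_lt hx), div_eq_inv_mul,
        Real.mul_rpow (by positivity) (le_of_lt hx0)]
    have hval := this.self_of_nhds
    rw [this.iteratedDeriv_eq, iteratedDeriv_const_mul_field, iteratedDeriv_eq_iterate,
      Real.iter_deriv_rpow_const, Real.rpow_sub_natCast hr.ne']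
    have heq : r ^ n * (N⁻¹ ^ (s - 1) *
        ((descPochhammer ℝ n).eval (s - 1) * (r ^ (s - 1) / r ^ n))) =
        (descPochhammer ℝ n).eval (s - 1) * m N r := by
      rw [hval]; field_simp
    rw [heq, abs_mul, abs_of_pos (hm.pos hN r)]
    have := mul_le_of_le_one_right h2 (hm.le_one hs1 hN r)
    linarith

end Multiplier

/-! ### Second differences of m(ξ)²|ξ|². -/

/-- A second difference of a function with Lipschitz derivative. -/
lemma abs_second_difference_le {E : Type*} [NormedAddCommGroup E] [NormedSpace ℝ E]
    {F : E → ℝ} {F' : E → E →L[ℝ] ℝ} (hF : ∀ x, HasFDerivAt F (F' x) x) {L : ℝ}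
    (hL : ∀ x y, ‖F' x - F' y‖ ≤ L * ‖x - y‖) (x a b : E) :
    |F x - F (x - a) - F (x - b) + F (x - a - b)| ≤ L * ‖a‖ * ‖b‖ := by
  -- The mean value inequality is applied to y ↦ F y - F (y - a) between x - b and x; its derivative
  -- is at most L‖a‖.
  have hg : ∀ y, HasFDerivAt (fun y => F y - F (y - a)) (F' y - F' (y - a)) y := fun y =>
    (hF y).sub ((hasFDerivAt_comp_sub a).2 (hF (y - a)))
  have := convex_univ.norm_image_sub_le_of_norm_hasFDerivWithin_le (C := L * ‖a‖)
    (fun y _ => (hg y).hasFDerivWithinAt) (fun y _ => by simpa using hL y (y - a))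
    (Set.mem_univ (x - b)) (Set.mem_univ x)
  simp only [Real.norm_eq_abs, sub_sub_cancel] at this
  refine le_trans (le_of_eq ?_) this
  rw [sub_right_comm x a b]
  congr 1
  ring

/-- A radial vector field `K(|x|) x` is Lipschitz if `K` and `r K'` are bounded. -/
lemma norm_radial_sub_le {E : Type*} [NormedAddCommGroup E] [NormedSpace ℝ E]
    {K K' : ℝ → ℝ} {A B : ℝ} (hA : ∀ r, 0 ≤ r → |K r| ≤ A)
    (hK : ∀ r, 0 < r → HasDerivAt K (K' r) r) (hB : ∀ r, 0 < r → |r * K' r| ≤ B) (x y : E) :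
    ‖K ‖x‖ • x - K ‖y‖ • y‖ ≤ (A + B) * ‖x - y‖ := by
  wlog h : ‖y‖ ≤ ‖x‖ generalizing x y
  · rw [norm_sub_rev, norm_sub_rev x]
    exact this y x (le_of_not_ge h)
  -- The variation of K multiplies the shorter vector, so ‖y‖ ≤ r along the interval and the bound
  -- on r K' suffices, even near 0.
  have key : |K ‖x‖ - K ‖y‖| * ‖y‖ ≤ B * (‖x‖ - ‖y‖) := by
    rcases (norm_nonneg y).eq_or_lt with h0 | h0
    · rw [← h0, mul_zero]
      have := (abs_nonneg _).trans (hB 1 one_pos)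
      have := norm_nonneg x
      positivity
    · have := (convex_Icc ‖y‖ ‖x‖).norm_image_sub_le_of_norm_hasDerivWithin_le (C := B / ‖y‖)
        (fun r hr => (hK r (h0.trans_le hr.1)).hasDerivWithinAt) (fun r hr => ?_)
        (Set.left_mem_Icc.2 h) (Set.right_mem_Icc.2 h)
      · rw [Real.norm_eq_abs, Real.norm_eq_abs, abs_of_nonneg (sub_nonneg.2 h)] at this
        calc _ ≤ B / ‖y‖ * (‖x‖ - ‖y‖) * ‖y‖ := by gcongr
          _ = _ := by field_simp
      · have hr0 := h0.trans_le hr.1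
        rw [Real.norm_eq_abs, le_div_iff₀ h0]
        calc |K' r| * ‖y‖ ≤ |K' r| * r := by gcongr; exact hr.1
          _ = |r * K' r| := by rw [abs_mul, abs_of_pos hr0, mul_comm]
          _ ≤ B := hB r hr0
  have hB0 := (abs_nonneg _).trans (hB 1 one_pos)
  calc ‖K ‖x‖ • x - K ‖y‖ • y‖ = ‖K ‖x‖ • (x - y) + (K ‖x‖ - K ‖y‖) • y‖ := by
        congr 1; module
    _ ≤ |K ‖x‖| * ‖x - y‖ + |K ‖x‖ - K ‖y‖| * ‖y‖ := by
        refine (norm_add_le _ _).trans ?_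
        rw [norm_smul, norm_smul, Real.norm_eq_abs, Real.norm_eq_abs]
    _ ≤ A * ‖x - y‖ + B * ‖x - y‖ := by
        refine add_le_add ?_ (key.trans ?_)
        · gcongr; exact hA _ (norm_nonneg x)
        · gcongr; exact norm_sub_norm_le x y
    _ = _ := by ring

/-- The gradient of m²|x|² is K(|x|)x with K = 2m·rm' + 2m². Both K and rK' are polynomials in m,
rm' and r²m'', hence bounded uniformly in N. -/
lemma IsIMultiplier.second_difference_bound {s : ℝ} {m : ℝ → ℝ → ℝ} (hs1 : s < 1)
    (hm : IsIMultiplier s m) : ∃ L : ℝ, 0 ≤ L ∧ ∀ N : ℝ, 1 ≤ N → ∀ F : Plane → ℝ,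
      (∀ x, F x = m N ‖x‖ ^ 2 * ‖x‖ ^ 2) → ∀ x a b : Plane,
        |F x - F (x - a) - F (x - b) + F (x - a - b)| ≤ L * ‖a‖ * ‖b‖ := by
  obtain ⟨B₁, hB₁0, hB₁⟩ := hm.pow_mul_iteratedDeriv_bound hs1 1
  obtain ⟨B₂, hB₂0, hB₂⟩ := hm.pow_mul_iteratedDeriv_bound hs1 2
  refine ⟨(2 * B₁ + 2) + (2 * B₁ ^ 2 + 2 * B₂ + 6 * B₁), by positivity, fun N hN F hF => ?_⟩
  obtain rfl : F = fun x => m N ‖x‖ ^ 2 * ‖x‖ ^ 2 := funext hF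
  have hN0 : 0 < N := by linarith
  have hsm : ContDiff ℝ 2 (m N) := mod_cast contDiff_infty.1 (hm.smooth N hN) 2
  have hd : ∀ r, HasDerivAt (m N) (deriv (m N) r) r := fun r =>
    (hsm.differentiable (by norm_num) r).hasDerivAt
  have hd2 : ∀ r, HasDerivAt (deriv (m N)) (deriv (deriv (m N)) r) r := fun r => by
    have : ContDiff ℝ 1 (deriv (m N)) := by
      rw [show (2 : WithTop ℕ∞) = 1 + 1 by norm_num, contDiff_succ_iff_deriv] at hsm
      exact hsm.2.2
    exact (this.differentiable (by norm_num) r).hasDerivAt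
  have b0 : ∀ r, |m N r| ≤ 1 := fun r => by
    rw [abs_of_pos (hm.pos hN r)]; exact hm.le_one hs1 hN r
  have b1 : ∀ r, 0 < r → |r * deriv (m N) r| ≤ B₁ := fun r hr => by
    simpa using hB₁ N hN r hr
  have b2 : ∀ r, 0 < r → |r ^ 2 * deriv (deriv (m N)) r| ≤ B₂ := fun r hr => by
    simpa [iteratedDeriv_succ] using hB₂ N hN r hr
  set K : ℝ → ℝ := fun r => 2 * m N r * (r * deriv (m N) r) + 2 * m N r ^ 2 with hK
  set K' : ℝ → ℝ := fun r => 2 * deriv (m N) r * (r * deriv (m N) r) +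
    2 * m N r * (deriv (m N) r + r * deriv (deriv (m N)) r) + 4 * m N r * deriv (m N) r with hK'
  have hlow : ∀ r, r < N → K r = 2 := by
    intro r hr
    have : m N =ᶠ[nhds r] fun _ => 1 := by
      filter_upwards [Iio_mem_nhds hr] with x hx using hm.low N hN x (le_of_lt hx)
    simp [hK, this.deriv_eq, hm.low N hN r hr.le]
  have hfd : ∀ x : Plane, HasFDerivAt (fun x : Plane => m N ‖x‖ ^ 2 * ‖x‖ ^ 2)
      (innerSL ℝ (K ‖x‖ • x)) x := by
    intro x
    -- Inside the ball F is |x|², which avoids differentiating the norm at 0; outside, the chain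
    -- rule applies.
    rcases lt_or_ge ‖x‖ N with hx | hx
    · rw [hlow _ hx]
      have h1 : HasFDerivAt (fun x : Plane => ‖x‖ ^ 2) (innerSL ℝ ((2 : ℝ) • x)) x := by
        refine (hasStrictFDerivAt_norm_sq x).hasFDerivAt.congr_fderiv ?_
        ext y
        simp [two_mul]
      refine h1.congr_of_eventuallyEq ?_
      filter_upwards [(continuous_norm.isOpen_preimage _ isOpen_Iio).mem_nhds hx] with y hy
      rw [hm.low N hN _ (le_of_lt hy)]
      ring
    · have hx0 : 0 < ‖x‖ := hN0.trans_le hx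
      have h1 : HasFDerivAt (fun x : Plane => ‖x‖) (innerSL ℝ (‖x‖⁻¹ • x)) x := by
        have h2 := (hasStrictFDerivAt_norm_sq x).hasFDerivAt.sqrt (by positivity)
        simp only [Real.sqrt_sq (norm_nonneg _)] at h2
        refine h2.congr_fderiv ?_
        ext y
        simp
        field_simp
      have h2 : HasDerivAt (fun r => m N r ^ 2 * r ^ 2) (‖x‖ * K ‖x‖) ‖x‖ := by
        refine (((hd ‖x‖).pow 2).mul (hasDerivAt_pow 2 ‖x‖)).congr_deriv ?_
        simp only [hK, Pi.pow_apply]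
        ring
      refine (h2.comp_hasFDerivAt x h1).congr_fderiv ?_
      ext y
      simp
      field_simp
  refine abs_second_difference_le hfd fun x y => ?_
  rw [← map_sub, innerSL_apply_norm]
  refine norm_radial_sub_le (K' := K') (fun r hr => ?_) (fun r _ => ?_) (fun r hr => ?_) x y
  · rcases hr.eq_or_lt with h0 | h0
    · rw [← h0, hlow 0 hN0]; norm_num; linarith
    · calc |K r| ≤ |2 * m N r * (r * deriv (m N) r)| + |2 * m N r ^ 2| := abs_add_le _ _
        _ = 2 * |m N r| * |r * deriv (m N) r| + 2 * |m N r| ^ 2 := by simp [abs_mul]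
        _ ≤ 2 * 1 * B₁ + 2 * 1 ^ 2 := by
          gcongr
          · exact b0 r
          · exact b1 r h0
          · exact b0 r
        _ = _ := by ring
  · refine ((((hd r).const_mul 2).mul ((hasDerivAt_id r).mul (hd2 r))).add
      (((hd r).pow 2).const_mul 2)).congr_deriv ?_
    simp only [hK', id, Pi.mul_apply]
    ring
  · calc |r * K' r| = |2 * (r * deriv (m N) r) ^ 2 + 2 * m N r * (r ^ 2 * deriv (deriv (m N)) r) +
          6 * m N r * (r * deriv (m N) r)| := by
          congr 1; simp only [hK']; ring
      _ ≤ |2 * (r * deriv (m N) r) ^ 2| + |2 * m N r * (r ^ 2 * deriv (deriv (m N)) r)| +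
          |6 * m N r * (r * deriv (m N) r)| := abs_add_three _ _ _
      _ = 2 * |r * deriv (m N) r| ^ 2 + 2 * |m N r| * |r ^ 2 * deriv (deriv (m N)) r| +
          6 * |m N r| * |r * deriv (m N) r| := by simp [abs_mul]
      _ ≤ 2 * B₁ ^ 2 + 2 * 1 * B₂ + 6 * 1 * B₁ := by
          gcongr
          · exact b1 r hr
          · exact b0 r
          · exact b2 r hr
          · exact b0 r
          · exact b1 r hr
      _ = _ := by ring

/-! ### Integration over Σ₄ of products of L² and L¹ functions. -/

/-- The quadrilinear form `∫ f₀(x) f₁(y) f₂(z) f₃(-x-y-z)`. -/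
noncomputable def quadForm (f₀ f₁ f₂ f₃ : Plane → ℝ≥0∞) : ℝ≥0∞ :=
  ∫⁻ x, ∫⁻ y, ∫⁻ z, f₀ x * f₁ y * f₂ z * f₃ (-(x + y + z))

section QuadForm

variable {f₀ f₁ f₂ f₃ : Plane → ℝ≥0∞}

lemma quadForm_swap01 (h₀ : Measurable f₀) (h₁ : Measurable f₁) (h₂ : Measurable f₂)
    (h₃ : Measurable f₃) : quadForm f₀ f₁ f₂ f₃ = quadForm f₁ f₀ f₂ f₃ := by
  unfold quadForm
  rw [lintegral_lintegral_swap (Measurable.aemeasurable (by fun_prop))]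
  simp_rw [mul_comm (f₀ _) (f₁ _), add_comm]

lemma quadForm_swap12 (h₁ : Measurable f₁) (h₂ : Measurable f₂)
    (h₃ : Measurable f₃) : quadForm f₀ f₁ f₂ f₃ = quadForm f₀ f₂ f₁ f₃ := by
  unfold quadForm
  congr 1 with x
  rw [lintegral_lintegral_swap (Measurable.aemeasurable (by fun_prop))]
  simp_rw [mul_right_comm, add_right_comm]

lemma quadForm_swap23 : quadForm f₀ f₁ f₂ f₃ = quadForm f₀ f₁ f₃ f₂ := by
  unfold quadForm
  congr 1 with x
  congr 1 with y
  rw [← lintegral_sub_left_eq_self _ (-(x + y))]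
  congr 1 with z
  rw [mul_right_comm]
  congr 3 <;> abel_nf

lemma lintegral_mul_sq_le {α : Type*} [MeasurableSpace α] {μ : Measure α} {f g : α → ℝ≥0∞}
    (hf : AEMeasurable f μ) (hg : AEMeasurable g μ) :
    (∫⁻ x, f x * g x ∂μ) ^ 2 ≤ (∫⁻ x, f x ^ 2 ∂μ) * ∫⁻ x, g x ^ 2 ∂μ := by
  have h := ENNReal.lintegral_mul_le_Lp_mul_Lq μ Real.HolderConjugate.two_two hf hg
  simp only [Pi.mul_apply, ENNReal.rpow_ofNat] at h
  calc _ ≤ ((∫⁻ x, f x ^ 2 ∂μ) ^ (1 / 2 : ℝ) * (∫⁻ x, g x ^ 2 ∂μ) ^ (1 / 2 : ℝ)) ^ 2 := by gcongr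
    _ = _ := by
      rw [mul_pow, ← ENNReal.rpow_mul_natCast, ← ENNReal.rpow_mul_natCast]
      norm_num

/-- The inner integral in z is a convolution of two L² functions, bounded pointwise by
Cauchy–Schwarz; the other two functions then integrate separately. -/
lemma quadForm_le (h₀ : Measurable f₀) (h₁ : Measurable f₁) (h₂ : Measurable f₂)
    (h₃ : Measurable f₃) {A : ℝ≥0∞} (hA₂ : ∫⁻ x, f₂ x ^ 2 ≤ A ^ 2) (hA₃ : ∫⁻ x, f₃ x ^ 2 ≤ A ^ 2) :
    quadForm f₀ f₁ f₂ f₃ ≤ (∫⁻ x, f₀ x) * (∫⁻ x, f₁ x) * A ^ 2 := by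
  have key : ∀ w : Plane, ∫⁻ z, f₂ z * f₃ (-(w + z)) ≤ A ^ 2 := by
    intro w
    have h := lintegral_mul_sq_le (μ := (volume : Measure Plane)) (f := f₂)
      (g := fun z => f₃ (-(w + z))) h₂.aemeasurable (Measurable.aemeasurable (by fun_prop))
    have h3 : ∫⁻ z, f₃ (-(w + z)) ^ 2 = ∫⁻ z, f₃ z ^ 2 := by
      rw [← lintegral_sub_left_eq_self (fun z => f₃ z ^ 2) (-w)]
      congr 1 with z
      congr 2
      abel
    rw [h3] at h
    have h4 : (∫⁻ z, f₂ z * f₃ (-(w + z))) ^ 2 ≤ (A ^ 2) ^ 2 :=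
      h.trans (by rw [sq (A ^ 2)]; gcongr)
    exact (ENNReal.pow_le_pow_left_iff two_ne_zero).1 h4
  calc quadForm f₀ f₁ f₂ f₃ = ∫⁻ x, ∫⁻ y, f₀ x * f₁ y * ∫⁻ z, f₂ z * f₃ (-(x + y + z)) := by
        unfold quadForm
        congr 1 with x
        congr 1 with y
        rw [← lintegral_const_mul _ (by fun_prop)]
        simp_rw [mul_assoc]
    _ ≤ ∫⁻ x, ∫⁻ y, f₀ x * f₁ y * A ^ 2 := by gcongr; exact key _
    _ = _ := by
      simp_rw [lintegral_mul_const _ (h₁.const_mul _), lintegral_const_mul _ h₁]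
      rw [lintegral_mul_const _ (h₀.mul_const _), lintegral_mul_const _ h₀]

end QuadForm

lemma measurable_sigmaParam (n : ℕ) : Measurable (sigmaParam n) := by
  unfold sigmaParam
  refine measurable_pi_iff.2 fun j => ?_
  refine Fin.lastCases ?_ (fun i => ?_) j
  · simp only [Fin.snoc_last]; fun_prop
  · simp only [Fin.snoc_castSucc]; fun_prop

lemma lintegral_fin_three {f : (Fin 3 → Plane) → ℝ≥0∞} (hf : Measurable f) :
    ∫⁻ η, f η = ∫⁻ x, ∫⁻ y, ∫⁻ z, f ![x, y, z] := by
  have e1 := (volume_preserving_piFinSuccAbove (fun _ : Fin 3 => Plane) 0).symm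
  have e2 := (volume_preserving_piFinTwo (fun _ : Fin 2 => Plane)).symm
  rw [← e1.lintegral_comp hf, Measure.volume_eq_prod, lintegral_prod _ (by
    exact (hf.comp (MeasurableEquiv.measurable _)).aemeasurable)]
  congr 1 with x
  have hm : Measurable fun η : Fin 2 → Plane =>
      f ((MeasurableEquiv.piFinSuccAbove (fun _ : Fin 3 => Plane) 0).symm (x, η)) := by fun_prop
  rw [← e2.lintegral_comp hm, Measure.volume_eq_prod, lintegral_prod _ (by
    exact (hm.comp (MeasurableEquiv.measurable _)).aemeasurable)]
  congr 1 with y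
  congr 1 with z
  congr 1
  ext i : 1
  fin_cases i <;> rfl

lemma lintegral_sigmaMeasure_prod {f : Fin 4 → Plane → ℝ≥0∞} (hf : ∀ j, Measurable (f j)) :
    ∫⁻ ξ, ∏ j, f j (ξ j) ∂(sigmaMeasure 3) = quadForm (f 0) (f 1) (f 2) (f 3) := by
  have hm : Measurable fun ξ : Fin 4 → Plane => ∏ j, f j (ξ j) :=
    Finset.measurable_fun_prod _ fun j _ => (hf j).comp (measurable_pi_apply j)
  rw [sigmaMeasure, lintegral_map hm (measurable_sigmaParam 3),
    lintegral_fin_three (f := fun η => ∏ j, f j (sigmaParam 3 η j))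
      (hm.comp (measurable_sigmaParam 3)), quadForm]
  congr 1 with x
  congr 1 with y
  congr 1 with z
  rw [Fin.prod_univ_four]
  have h3 : sigmaParam 3 ![x, y, z] 3 = -(x + y + z) := by
    change -∑ j, (![x, y, z] : Fin 3 → Plane) j = _
    rw [Fin.sum_univ_three]
    rfl
  rw [h3]
  rfl

/-- The integral over `Σ₄` of a product of two functions in `L²` and two functions in `L¹`. -/
lemma lintegral_sigmaMeasure_pair_le {w v : Fin 4 → Plane → ℝ≥0∞} (hw : ∀ j, Measurable (w j))
    (hv : ∀ j, Measurable (v j)) {A V : ℝ≥0∞} (hA : ∀ j, ∫⁻ x, w j x ^ 2 ≤ A ^ 2)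
    (hV : ∀ j, ∫⁻ x, v j x ≤ V) {i k : Fin 4} (hik : i ≠ k) :
    ∫⁻ ξ, ∏ j, (if j = i ∨ j = k then w j (ξ j) else v j (ξ j)) ∂(sigmaMeasure 3) ≤
      V * V * A ^ 2 := by
  have hm : ∀ j, Measurable (if j = i ∨ j = k then w j else v j) := fun j => by
    split_ifs
    exacts [hw j, hv j]
  have h := lintegral_sigmaMeasure_prod hm
  have e : ∀ (ξ : Fin 4 → Plane) (j : Fin 4), (if j = i ∨ j = k then w j else v j) (ξ j) =
      if j = i ∨ j = k then w j (ξ j) else v j (ξ j) := fun ξ j => by split_ifs <;> rfl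
  simp only [e] at h
  rw [h]
  -- The six positions of the two L² functions are all reduced by transpositions to the last two
  -- slots.
  have base : ∀ a b c d : Fin 4, quadForm (v a) (v b) (w c) (w d) ≤ V * V * A ^ 2 :=
    fun a b c d => (quadForm_le (hv a) (hv b) (hw c) (hw d) (hA c) (hA d)).trans
      (by gcongr <;> exact hV _)
  have b1 : ∀ a b c d : Fin 4, quadForm (v a) (w b) (v c) (w d) ≤ V * V * A ^ 2 :=
    fun a b c d => by rw [quadForm_swap12 (hw b) (hv c) (hw d)]; exact base _ _ _ _
  have b2 : ∀ a b c d : Fin 4, quadForm (v a) (w b) (w c) (v d) ≤ V * V * A ^ 2 :=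
    fun a b c d => by rw [quadForm_swap23]; exact b1 _ _ _ _
  have b3 : ∀ a b c d : Fin 4, quadForm (w a) (v b) (v c) (w d) ≤ V * V * A ^ 2 :=
    fun a b c d => by rw [quadForm_swap01 (hw a) (hv b) (hv c) (hw d)]; exact b1 _ _ _ _
  have b4 : ∀ a b c d : Fin 4, quadForm (w a) (v b) (w c) (v d) ≤ V * V * A ^ 2 :=
    fun a b c d => by rw [quadForm_swap23]; exact b3 _ _ _ _
  have b5 : ∀ a b c d : Fin 4, quadForm (w a) (w b) (v c) (v d) ≤ V * V * A ^ 2 :=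
    fun a b c d => by rw [quadForm_swap12 (hw b) (hv c) (hv d)]; exact b4 _ _ _ _
  fin_cases i <;> fin_cases k <;> first | exact absurd rfl hik | skip
  all_goals simp [base, b1, b2, b3, b4, b5]

/-! ### The symbols on `Σ₄` -/

lemma mem_sigmaSet_four {ξ : Fin 4 → Plane} :
    ξ ∈ sigmaSet 4 ↔ ξ 0 + ξ 1 + ξ 2 + ξ 3 = 0 := by
  simp [sigmaSet, Fin.sum_univ_four]

lemma extendSymbol_sigma2 (ρ : ℝ → ℝ) {ξ : Fin 4 → Plane} (h : ξ ∈ sigmaSet 4) :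
    extendSymbol (n := 1) (sigma2 ρ) ξ = ((1 / 2 * (ρ ‖ξ 3‖ ^ 2 * ‖ξ 3‖ ^ 2) : ℝ) : ℂ) := by
  have h' : ξ 0 + ξ 1 + ξ 2 = -ξ 3 := eq_neg_of_add_eq_zero_left (mem_sigmaSet_four.1 h)
  have e : (Fin.succ (Fin.succ (Fin.succ (0 : Fin 1))) : Fin 4) = 3 := rfl
  simp only [extendSymbol, sigma2, Fin.cons_zero, Fin.cons_one, h', e, norm_neg, smul_neg,
    inner_neg_left, inner_smul_left, inner_smul_right, real_inner_self_eq_norm_sq]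
  norm_num
  ring

lemma symGroup_four : symGroup 4 = Finset.univ.filter fun g : Equiv.Perm (Fin 4) =>
    (∀ j, (g j : ℕ) % 2 = (j : ℕ) % 2) ∨ ∀ j, (g j : ℕ) % 2 ≠ (j : ℕ) % 2 := by
  unfold symGroup ParityPreserving ParityReversing
  congr

lemma card_symGroup_four : (symGroup 4).card = 8 := by
  rw [symGroup_four]
  decide

lemma card_symGroup_four_fiber (j : Fin 4) : ((symGroup 4).filter fun g => g 3 = j).card = 2 := by
  rw [symGroup_four]
  revert j
  decide

/-- On Σ₄ the symbol 2iX(σ₂) is iF(ξ₄), so g acts only through g 3. Each index is hit by 2 of the 8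
elements, giving the factor 1/4; parity-reversing elements conjugate i, giving the minus signs. -/
lemma symmetrize_extendSymbol_sigma2 (ρ : ℝ → ℝ) {F : Plane → ℝ}
    (hF : ∀ x, F x = ρ ‖x‖ ^ 2 * ‖x‖ ^ 2) {ξ : Fin 4 → Plane} (h : ξ ∈ sigmaSet 4) :
    symmetrize (fun ζ : Fin 4 → Plane => 2 * Complex.I * extendSymbol (sigma2 ρ) ζ) ξ =
      Complex.I * ((1 / 4 * (-F (ξ 0) + F (ξ 1) - F (ξ 2) + F (ξ 3)) : ℝ) : ℂ) := by
  set φ : Fin 4 → ℂ := fun j =>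
    if (j : ℕ) % 2 = 1 then Complex.I * (F (ξ j) : ℂ) else -(Complex.I * (F (ξ j) : ℂ)) with hφ
  have hact : ∀ g ∈ symGroup 4, symAct g
      (fun ζ : Fin 4 → Plane => 2 * Complex.I * extendSymbol (sigma2 ρ) ζ) ξ = φ (g 3) := by
    intro g hg
    have hmem : (fun j => ξ (g j)) ∈ sigmaSet 4 := by
      rw [sigmaSet, Set.mem_ofPred_eq] at h ⊢
      rw [← h]
      exact Equiv.sum_comp g ξ
    simp only [symGroup, Finset.mem_filter, Finset.mem_univ, true_and] at hg
    rw [symAct, extendSymbol_sigma2 ρ hmem, ← hF]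
    by_cases hp : ParityPreserving g
    · have h3 : (g 3 : ℕ) % 2 = 1 := hp 3
      simp only [hp, if_true, hφ, h3]
      push_cast
      ring
    · have h3 : ¬ (g 3 : ℕ) % 2 = 1 := (hg.resolve_left hp) 3
      simp only [hp, if_false, hφ, h3]
      simp only [map_mul, Complex.conj_I, Complex.conj_ofReal, map_ofNat]
      push_cast
      ring
  rw [symmetrize, Finset.sum_congr rfl hact, card_symGroup_four,
    ← Finset.sum_fiberwise (symGroup 4) (fun g => g 3)]
  have hfib : ∀ j : Fin 4, ∑ g ∈ symGroup 4 with g 3 = j, φ (g 3) = 2 * φ j := by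
    intro j
    rw [Finset.sum_congr rfl (g := fun _ => φ j)
      (fun g hg => by rw [(Finset.mem_filter.1 hg).2]), Finset.sum_const,
      card_symGroup_four_fiber, nsmul_eq_mul]
    norm_num
  simp only [hfib, Fin.sum_univ_four]
  simp [hφ]
  ring

lemma alpha4_eq_inner {ξ : Fin 4 → Plane} (h : ξ ∈ sigmaSet 4) :
    alpha4 ξ = -2 * inner ℝ (ξ 0 + ξ 1) (ξ 0 + ξ 3) := by
  have h3 : ξ 3 = -(ξ 0 + ξ 1 + ξ 2) := eq_neg_of_add_eq_zero_right (mem_sigmaSet_four.1 h)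
  rw [alpha4, h3, norm_neg]
  simp only [← real_inner_self_eq_norm_sq, inner_add_left, inner_add_right, inner_neg_right,
    real_inner_comm (ξ 1) (ξ 0), real_inner_comm (ξ 2) (ξ 0), real_inner_comm (ξ 2) (ξ 1)]
  ring

/-- On Σ₄ the points ξ₁, -ξ₂, ξ₃, -ξ₄ are the vertices of a parallelogram with sides ξ₁₂ and ξ₁₄,
and F is even. -/
lemma second_difference_eq {F : Plane → ℝ} (hF : ∀ x, F (-x) = F x) {ξ : Fin 4 → Plane}
    (h : ξ ∈ sigmaSet 4) :
    -F (ξ 0) + F (ξ 1) - F (ξ 2) + F (ξ 3) = -(F (ξ 0) - F (ξ 0 - (ξ 0 + ξ 1)) -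
      F (ξ 0 - (ξ 0 + ξ 3)) + F (ξ 0 - (ξ 0 + ξ 1) - (ξ 0 + ξ 3))) := by
  have h3 : ξ 3 = -(ξ 0 + ξ 1 + ξ 2) := eq_neg_of_add_eq_zero_right (mem_sigmaSet_four.1 h)
  have e1 : ξ 0 - (ξ 0 + ξ 1) = -ξ 1 := by abel
  have e2 : ξ 0 - (ξ 0 + ξ 3) = -ξ 3 := by abel
  have e3 : ξ 0 - (ξ 0 + ξ 1) - (ξ 0 + ξ 3) = ξ 2 := by rw [h3]; abel
  rw [e3, e1, e2, hF, hF]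
  ring

lemma IsIMultiplier.symbol_eq_zero {s : ℝ} {m : ℝ → ℝ → ℝ} (hm : IsIMultiplier s m) {N : ℝ}
    (hN : 1 ≤ N) (θ₀ : ℝ) {ξ : Fin 4 → Plane} (h : ξ ∈ sigmaSet 4) (hξ : ∀ j, ‖ξ j‖ ≤ N)
    (hα : alpha4 ξ ≠ 0) : sigma4 (m N) ξ - sigmaTilde4 (m N) N θ₀ ξ = 0 := by
  have hmem : ξ ∈ nonResonant N θ₀ := Or.inl ⟨h, hξ⟩
  rw [sigmaTilde4, Set.indicator_of_mem hmem,
    symmetrize_extendSymbol_sigma2 (m N) (fun x => rfl) h, sigma4]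
  simp only [hm.low N hN _ (hξ _), Finset.prod_const_one, one_pow, one_mul, mul_one]
  rw [← alpha4, mul_div_mul_left _ _ Complex.I_ne_zero, sub_eq_zero, eq_div_iff (by exact_mod_cast hα)]
  push_cast
  ring

lemma IsIMultiplier.symbol_bound {s : ℝ} {m : ℝ → ℝ → ℝ} (hs1 : s < 1)
    (hm : IsIMultiplier s m) : ∃ C : ℝ, 0 < C ∧ ∀ N : ℝ, 1 ≤ N → ∀ θ₀ : ℝ, 0 < θ₀ →
      θ₀ < 1 / 100 → ∀ ξ ∈ sigmaSet 4, (∃ j, N < ‖ξ j‖) →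
        ‖sigma4 (m N) ξ - sigmaTilde4 (m N) N θ₀ ξ‖ ≤ C * θ₀⁻¹ := by
  obtain ⟨L, hL0, hL⟩ := hm.second_difference_bound hs1
  refine ⟨1 + L, by positivity, fun N hN θ₀ hθ hθ1 ξ hξ hj => ?_⟩
  have hθi : 1 ≤ θ₀⁻¹ := (one_le_inv₀ hθ).2 (by linarith)
  have h4 : ‖sigma4 (m N) ξ‖ ≤ θ₀⁻¹ := by
    rw [sigma4, Complex.norm_real, Real.norm_eq_abs, abs_mul, Finset.abs_prod]
    have : ∏ j, |m N ‖ξ j‖| ≤ 1 := Finset.prod_le_one (fun _ _ => abs_nonneg _) fun j _ => by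
      rw [abs_of_pos (hm.pos hN _)]; exact hm.le_one hs1 hN _
    norm_num
    linarith
  have h5 : ‖sigmaTilde4 (m N) N θ₀ ξ‖ ≤ L * θ₀⁻¹ := by
    rw [sigmaTilde4, Set.indicator]
    split_ifs with hmem
    swap
    · rw [norm_zero]; positivity
    -- A frequency above N rules out the low-frequency part of Ω_nr, so only the angle condition is
    -- left.
    have hcos : θ₀ ≤ |Real.cos (InnerProductGeometry.angle (ξ 0 + ξ 1) (ξ 0 + ξ 3))| := by
      rcases hmem with hmem | hmem
      · obtain ⟨j, hj⟩ := hj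
        exact absurd (hmem.2 j) (not_le.2 hj)
      · exact hmem.2
    rw [symmetrize_extendSymbol_sigma2 (m N) (F := fun x => m N ‖x‖ ^ 2 * ‖x‖ ^ 2) (fun x => rfl) hξ,
      mul_div_mul_left _ _ Complex.I_ne_zero, ← Complex.ofReal_div, Complex.norm_real,
      Real.norm_eq_abs, second_difference_eq (F := fun x => m N ‖x‖ ^ 2 * ‖x‖ ^ 2) (by simp) hξ,
      alpha4_eq_inner hξ]
    have hD := hL N hN (fun x => m N ‖x‖ ^ 2 * ‖x‖ ^ 2) (fun x => rfl) (ξ 0) (ξ 0 + ξ 1) (ξ 0 + ξ 3)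
    have hin := InnerProductGeometry.cos_angle_mul_norm_mul_norm (ξ 0 + ξ 1) (ξ 0 + ξ 3)
    set D := m N ‖ξ 0‖ ^ 2 * ‖ξ 0‖ ^ 2 - m N ‖ξ 0 - (ξ 0 + ξ 1)‖ ^ 2 * ‖ξ 0 - (ξ 0 + ξ 1)‖ ^ 2 -
      m N ‖ξ 0 - (ξ 0 + ξ 3)‖ ^ 2 * ‖ξ 0 - (ξ 0 + ξ 3)‖ ^ 2 +
      m N ‖ξ 0 - (ξ 0 + ξ 1) - (ξ 0 + ξ 3)‖ ^ 2 * ‖ξ 0 - (ξ 0 + ξ 1) - (ξ 0 + ξ 3)‖ ^ 2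
    set c := Real.cos (InnerProductGeometry.angle (ξ 0 + ξ 1) (ξ 0 + ξ 3))
    set a := ‖ξ 0 + ξ 1‖
    set b := ‖ξ 0 + ξ 3‖
    have ha : 0 ≤ a := norm_nonneg _
    have hb : 0 ≤ b := norm_nonneg _
    rw [← hin]
    have e : |1 / 4 * -D / (-2 * (c * (a * b)))| = |D| / (8 * (|c| * (a * b))) := by
      rw [abs_div, abs_mul, abs_neg, abs_mul, abs_mul c, abs_of_nonneg (mul_nonneg ha hb)]
      norm_num
      rw [mul_div_mul_comm]
      ring
    rw [e]
    -- If a side degenerates, the denominator is 0 and the quotient is 0 by convention.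
    rcases (mul_nonneg ha hb).eq_or_lt with h0 | h0
    · rw [← h0]; simp; positivity
    · rw [div_le_iff₀ (by have := hθ.trans_le hcos; positivity)]
      calc |D| ≤ L * a * b := hD
        _ = L * θ₀⁻¹ * (θ₀ * (a * b)) := by field_simp
        _ ≤ L * θ₀⁻¹ * (|c| * (a * b)) := by gcongr
        _ ≤ L * θ₀⁻¹ * (8 * (|c| * (a * b))) := by
          have : 0 ≤ |c| * (a * b) := by positivity
          exact mul_le_mul_of_nonneg_left (by linarith) (by positivity)
  calc _ ≤ ‖sigma4 (m N) ξ‖ + ‖sigmaTilde4 (m N) N θ₀ ξ‖ := norm_sub_le _ _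
    _ ≤ θ₀⁻¹ + L * θ₀⁻¹ := add_le_add h4 h5
    _ = _ := by ring

/-! ### Null sets and measurability -/

lemma measurableSet_sigmaSet (k : ℕ) : MeasurableSet (sigmaSet k) :=
  (isClosed_eq (by fun_prop) continuous_const).measurableSet

lemma ae_mem_sigmaSet (n : ℕ) : ∀ᵐ ξ ∂(sigmaMeasure n), ξ ∈ sigmaSet (n + 1) := by
  rw [sigmaMeasure, ae_map_iff (p := fun ξ => ξ ∈ sigmaSet (n + 1))
    (measurable_sigmaParam n).aemeasurable (measurableSet_sigmaSet _)]
  refine Filter.Eventually.of_forall fun η => ?_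
  simp [sigmaSet, sigmaParam, Fin.sum_univ_castSucc]

lemma measurable_alpha4 : Measurable alpha4 := by
  unfold alpha4
  fun_prop

lemma volume_setOf_inner_add_eq_zero {a : Plane} (ha : a ≠ 0) (y : Plane) :
    volume {z : Plane | inner ℝ a (y + z) = 0} = 0 := by
  have h : {z : Plane | inner ℝ a (y + z) = 0} =
      (fun z => y + z) ⁻¹' ((innerSL ℝ a).ker : Set Plane) := by
    ext z; simp
  rw [h, measure_preimage_add]
  refine Measure.addHaar_submodule _ _ fun htop => ha ?_
  have : a ∈ (innerSL ℝ a).ker := by rw [htop]; trivial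
  simpa using this

/-- Where α₄ = 0 the quotient is 0 by convention and the low-frequency cancellation fails. For fixed
x and y ≠ -x, the zero set in z is an affine line. -/
lemma ae_alpha4_ne_zero : ∀ᵐ ξ ∂(sigmaMeasure 3), alpha4 ξ ≠ 0 := by
  have hS : MeasurableSet {ξ : Fin 4 → Plane | alpha4 ξ ≠ 0} :=
    (measurableSet_eq_fun measurable_alpha4 measurable_const).compl
  have hS' : MeasurableSet {η : Fin 3 → Plane | alpha4 (sigmaParam 3 η) = 0} :=
    measurableSet_eq_fun (measurable_alpha4.comp (measurable_sigmaParam 3)) measurable_const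
  rw [sigmaMeasure, ae_map_iff (measurable_sigmaParam 3).aemeasurable hS, ae_iff]
  simp only [ne_eq, not_not]
  rw [← lintegral_indicator_one hS', lintegral_fin_three (measurable_one.indicator hS')]
  have hmem : ∀ x y z : Plane, alpha4 (sigmaParam 3 ![x, y, z]) = 0 ↔
      inner ℝ (x + y) (y + z) = 0 := by
    intro x y z
    have h : sigmaParam 3 ![x, y, z] ∈ sigmaSet 4 := by
      simp [sigmaSet, sigmaParam, Fin.sum_univ_castSucc]
    have h3 : sigmaParam 3 ![x, y, z] 3 = -(x + y + z) := by
      change -∑ j, (![x, y, z] : Fin 3 → Plane) j = _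
      rw [Fin.sum_univ_three]
      rfl
    have h0 : sigmaParam 3 ![x, y, z] 0 = x := rfl
    have h1 : sigmaParam 3 ![x, y, z] 1 = y := rfl
    rw [alpha4_eq_inner h, h3, h0, h1, show x + -(x + y + z) = -(y + z) by abel, inner_neg_right]
    constructor <;> intro h <;> linarith
  have hz : ∀ x y : Plane, y ≠ -x → ∫⁻ z, Set.indicator
      {η : Fin 3 → Plane | alpha4 (sigmaParam 3 η) = 0} (1 : (Fin 3 → Plane) → ℝ≥0∞) ![x, y, z]
        = 0 := by
    intro x y hxy
    have hne : x + y ≠ 0 := fun h => hxy (eq_neg_of_add_eq_zero_right h)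
    have hm : MeasurableSet {z : Plane | inner ℝ (x + y) (y + z) = 0} :=
      measurableSet_eq_fun (by fun_prop) measurable_const
    rw [← volume_setOf_inner_add_eq_zero hne y, ← lintegral_indicator_one hm]
    congr 1 with z
    simp [Set.indicator, hmem]
  rw [← lintegral_zero (μ := (volume : Measure Plane))]
  congr 1 with x
  rw [← lintegral_zero (μ := (volume : Measure Plane))]
  refine lintegral_congr_ae ?_
  filter_upwards [Measure.ae_ne volume (-x)] with y hy using hz x y hy

lemma continuous_hat_alternating {k : ℕ} (u : 𝓢(Plane, ℂ)) (j : Fin k) :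
    Continuous (hat (alternating u j)) := by
  obtain ⟨v, hv⟩ := exists_schwartzMap_eq_hat u
  unfold alternating
  split_ifs
  · rw [← hv]; exact v.continuous
  · have : hat (fun x => (starRingEnd ℂ) (u x)) = fun ξ => (starRingEnd ℂ) (v (-ξ)) := by
      ext ξ
      rw [hat_conj, hv]
    rw [this]
    exact Complex.continuous_conj.comp (v.continuous.comp continuous_neg)

/-- The explicit form of the symmetrized symbol holds only on Σ₄, so the integrand is compared
almost everywhere with a function measurable on the whole space. -/
lemma aestronglyMeasurable_integrand {ρ : ℝ → ℝ} (hρ : Continuous ρ) (N θ₀ : ℝ)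
    (u : 𝓢(Plane, ℂ)) :
    AEStronglyMeasurable (lambdaIntegrand (fun ξ => sigma4 ρ ξ - sigmaTilde4 ρ N θ₀ ξ)
      (alternating u)) (sigmaMeasure 3) := by
  set S : Set (Fin 4 → Plane) := {ξ | ∀ j, ‖ξ j‖ ≤ N} ∪ {ξ | θ₀ ≤ |inner ℝ (ξ 0 + ξ 1) (ξ 0 + ξ 3) /
    (‖ξ 0 + ξ 1‖ * ‖ξ 0 + ξ 3‖)|} with hS
  have hSm : MeasurableSet S := by
    refine MeasurableSet.union ?_ (measurableSet_le (by fun_prop) ?_)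
    · rw [Set.ofPred_forall]
      exact MeasurableSet.iInter fun j => measurableSet_le (by fun_prop) (by fun_prop)
    · exact (Measurable.div (by fun_prop) (by fun_prop)).abs
  set F : Plane → ℝ := fun x => ρ ‖x‖ ^ 2 * ‖x‖ ^ 2 with hF
  have hFc : Continuous F := by fun_prop
  set G : (Fin 4 → Plane) → ℂ := fun ξ =>
    (sigma4 ρ ξ - S.indicator (fun ξ => Complex.I *
      ((1 / 4 * (-F (ξ 0) + F (ξ 1) - F (ξ 2) + F (ξ 3)) : ℝ) : ℂ) /
        (Complex.I * (alpha4 ξ : ℂ))) ξ) * ∏ j, hat (alternating u j) (ξ j) with hG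
  have hGm : Measurable G := by
    refine Measurable.mul (Measurable.sub ?_ (Measurable.indicator ?_ hSm))
      (Finset.measurable_fun_prod _ fun j _ =>
        (continuous_hat_alternating u j).measurable.comp (measurable_pi_apply j))
    · unfold sigma4
      exact Continuous.measurable (by fun_prop)
    · refine Measurable.div (Continuous.measurable (by fun_prop)) ?_
      exact (Complex.measurable_ofReal.comp measurable_alpha4).const_mul _
  refine hGm.aestronglyMeasurable.congr ?_
  filter_upwards [ae_mem_sigmaSet 3] with ξ hξ
  rw [hG, lambdaIntegrand, sigmaTilde4]
  simp only [Set.indicator, symmetrize_extendSymbol_sigma2 ρ (F := F) (fun x => rfl) hξ]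
  have : ξ ∈ nonResonant N θ₀ ↔ ξ ∈ S := by
    simp [nonResonant, hS, hξ, InnerProductGeometry.cos_angle]
  simp only [this]

/-! ### The pointwise bound on the high-frequency region -/

/-- If four vectors sum to zero, the largest has a comparable partner. -/
lemma exists_ne_norm_le_three_mul {ξ : Fin 4 → Plane} (h : ξ ∈ sigmaSet 4) (i : Fin 4) :
    ∃ k, k ≠ i ∧ ‖ξ i‖ ≤ 3 * ‖ξ k‖ := by
  by_contra! hcon
  have h1 : ξ i = -∑ k ∈ Finset.univ.erase i, ξ k := by
    rw [eq_neg_iff_add_eq_zero, Finset.add_sum_erase _ _ (Finset.mem_univ i)]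
    exact h
  have h2 : ‖ξ i‖ ≤ ∑ k ∈ Finset.univ.erase i, ‖ξ k‖ := by
    conv_lhs => rw [h1, norm_neg]
    exact norm_sum_le _ _
  have hne : (Finset.univ.erase i).Nonempty := by
    rw [← Finset.card_pos, Finset.card_erase_of_mem (Finset.mem_univ i)]
    simp
  have h3 : ∑ k ∈ Finset.univ.erase i, ‖ξ k‖ < ∑ k ∈ Finset.univ.erase i, ‖ξ i‖ / 3 :=
    Finset.sum_lt_sum_of_nonempty hne fun k hk => by
      have := hcon k (Finset.ne_of_mem_erase hk)
      linarith
  rw [Finset.sum_const, Finset.card_erase_of_mem (Finset.mem_univ i)] at h3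
  simp only [Finset.card_univ, Fintype.card_fin, Nat.reduceSub, nsmul_eq_mul] at h3
  push_cast at h3
  linarith

/-- The weight `⟨x⟩ ^ (-(1 + δ))`. -/
noncomputable def bracketWeight (δ : ℝ) (x : Plane) : ℝ := √(1 + ‖x‖ ^ 2) ^ (-(1 + δ))

lemma bracketWeight_nonneg (δ : ℝ) (x : Plane) : 0 ≤ bracketWeight δ x := by
  unfold bracketWeight
  positivity

lemma measurable_bracketWeight (δ : ℝ) : Measurable (bracketWeight δ) := by
  unfold bracketWeight
  fun_prop

/-- The squared weight decays like |x|^{-2-2δ}, which beats the dimension 2. -/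
lemma lintegral_bracketWeight_sq_lt_top {δ : ℝ} (hδ : 0 < δ) :
    ∫⁻ x, ENNReal.ofReal (bracketWeight δ x) ^ 2 < ⊤ := by
  have h := (integrable_rpow_neg_one_add_norm_sq (E := Plane) (μ := volume) (r := 2 + 2 * δ)
    (by simp [hδ])).lintegral_lt_top
  refine lt_of_eq_of_lt (lintegral_congr fun x => ?_) h
  rw [← ENNReal.ofReal_pow (bracketWeight_nonneg δ x)]
  congr 1
  rw [bracketWeight, Real.sqrt_eq_rpow, ← Real.rpow_mul (by positivity),
    ← Real.rpow_mul_natCast (by positivity)]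
  congr 1
  push_cast
  ring

lemma prod_pair_ite {i k : Fin 4} (hik : k ≠ i) (a b : ℝ) :
    ∏ j : Fin 4, (if j = i ∨ j = k then a else b) = a ^ 2 * b ^ 2 := by
  fin_cases i <;> fin_cases k <;> first | exact absurd rfl hik | skip
  all_goals
    simp [Fin.prod_univ_four]
    try ring

/-- With R the largest frequency, the product is at most a constant times (R/N)^{4-4s} R^{-2+2δ} =
(R/N)^{2-4s+2δ} N^{-2+2δ} times the weighted factors. -/
lemma IsIMultiplier.prod_norm_hat_le {s : ℝ} (hs : 1 / 2 < s) (hs1 : s < 1) {m : ℝ → ℝ → ℝ}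
    (hm : IsIMultiplier s m) {δ : ℝ} (hδ : 0 < δ) (hδ1 : δ ≤ 2 * s - 1) {N : ℝ} (hN : 1 ≤ N)
    (u : Fin 4 → Plane → ℂ) {ξ : Fin 4 → Plane} {i k : Fin 4} (hik : k ≠ i)
    (hmax : ∀ j, ‖ξ j‖ ≤ ‖ξ i‖) (hk : ‖ξ i‖ ≤ 3 * ‖ξ k‖) (hi : N < ‖ξ i‖) :
    ∏ j, ‖hat (u j) (ξ j)‖ ≤ 576 * N ^ (-2 + 2 * δ) *
      ∏ j, (if j = i ∨ j = k then weightedHat (m N) (u j) (ξ j)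
        else bracketWeight δ (ξ j) * weightedHat (m N) (u j) (ξ j)) := by
  set R := ‖ξ i‖ with hR
  have hN0 : 0 < N := by linarith
  have hR1 : 1 ≤ R := by linarith
  have hR0 : 0 < R := by linarith
  have hfac : ∀ j, ‖hat (u j) (ξ j)‖ ≤ (2 * (R / N) ^ (1 - s)) *
      ((if j = i ∨ j = k then 3 * R⁻¹ else 2 * R ^ δ) *
      (if j = i ∨ j = k then weightedHat (m N) (u j) (ξ j)
        else bracketWeight δ (ξ j) * weightedHat (m N) (u j) (ξ j))) := by
    intro j
    set q := √(1 + ‖ξ j‖ ^ 2) with hq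
    have hq1 : 1 ≤ q := by rw [hq]; exact Real.one_le_sqrt.2 (by nlinarith [norm_nonneg (ξ j)])
    have hqn : ‖ξ j‖ ≤ q := by
      rw [hq]; exact Real.le_sqrt_of_sq_le (by linarith)
    have hq0 : 0 < q := by linarith
    have hqR : q ≤ 2 * R := by
      rw [hq, Real.sqrt_le_left (by positivity)]
      nlinarith [hmax j, norm_nonneg (ξ j)]
    have hρ := hm.pos hN ‖ξ j‖
    have hW : 0 ≤ weightedHat (m N) (u j) (ξ j) := by unfold weightedHat; positivity
    have hinv := hm.inv_le (by linarith) hs1 hN (hmax j) hi.le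
    have heq : ‖hat (u j) (ξ j)‖ = (m N ‖ξ j‖)⁻¹ * (q⁻¹ * weightedHat (m N) (u j) (ξ j)) := by
      rw [weightedHat, abs_of_pos hρ, ← hq]
      field_simp
    rw [heq]
    refine mul_le_mul hinv ?_ (by positivity) (by positivity)
    split_ifs with hj
    · gcongr
      rw [← div_eq_mul_inv, ← one_div, div_le_div_iff₀ hq0 hR0, one_mul]
      rcases hj with rfl | rfl
      · linarith
      · linarith
    · rw [← mul_assoc]
      gcongr
      -- Since q ≤ 2R, the extra decay q^{-δ} of the weight is bought at the price 2R^δ.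
      rw [bracketWeight, ← hq, neg_add, Real.rpow_add hq0, Real.rpow_neg_one]
      have h2 : q ^ δ ≤ 2 * R ^ δ := by
        calc q ^ δ ≤ (2 * R) ^ δ := Real.rpow_le_rpow hq0.le hqR hδ.le
          _ = 2 ^ δ * R ^ δ := Real.mul_rpow (by norm_num) hR0.le
          _ ≤ 2 ^ (1 : ℝ) * R ^ δ := by
            gcongr
            · norm_num
            · linarith
          _ = _ := by rw [Real.rpow_one]
      calc q⁻¹ = q ^ δ * (q⁻¹ * q ^ (-δ)) := by
            rw [Real.rpow_neg hq0.le]; field_simp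
        _ ≤ _ := by gcongr
  set T := ∏ j, (if j = i ∨ j = k then weightedHat (m N) (u j) (ξ j)
        else bracketWeight δ (ξ j) * weightedHat (m N) (u j) (ξ j)) with hT
  have hT0 : 0 ≤ T := Finset.prod_nonneg fun j _ => by
    have hW : 0 ≤ weightedHat (m N) (u j) (ξ j) := by unfold weightedHat; positivity
    have := bracketWeight_nonneg δ (ξ j)
    split_ifs <;> positivity
  calc ∏ j, ‖hat (u j) (ξ j)‖ ≤ _ :=
        Finset.prod_le_prod (fun j _ => norm_nonneg _) fun j _ => hfac j
    _ = (2 * (R / N) ^ (1 - s)) ^ 4 * ((3 * R⁻¹) ^ 2 * (2 * R ^ δ) ^ 2 * T) := by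
        generalize 2 * (R / N) ^ (1 - s) = c
        rw [Finset.prod_mul_distrib, Finset.prod_mul_distrib, prod_pair_ite hik, ← hT]
        simp
    -- 576 = 2⁴·3²·2²: four factors m⁻¹, two large frequencies, two weights.
    _ = 576 * ((R / N) ^ (2 - 4 * s + 2 * δ) * N ^ (-2 + 2 * δ)) * T := by
        have e1 : ((R / N) ^ (1 - s)) ^ 4 = (R / N) ^ (4 - 4 * s) := by
          rw [← Real.rpow_mul_natCast (by positivity)]
          congr 1; push_cast; ring
        have e2 : (R⁻¹) ^ 2 * (R ^ δ) ^ 2 = R ^ (-2 + 2 * δ) := by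
          rw [Real.rpow_add hR0, ← Real.rpow_mul_natCast hR0.le, inv_pow, Real.rpow_neg hR0.le,
            Real.rpow_ofNat]
          congr 2; push_cast; ring
        have e3 : R ^ (-2 + 2 * δ) = (R / N) ^ (-2 + 2 * δ) * N ^ (-2 + 2 * δ) := by
          rw [← Real.mul_rpow (by positivity) hN0.le, div_mul_cancel₀ _ hN0.ne']
        have e4 : (R / N) ^ (4 - 4 * s) * (R / N) ^ (-2 + 2 * δ) =
            (R / N) ^ (2 - 4 * s + 2 * δ) := by
          rw [← Real.rpow_add (by positivity)]; congr 1; ring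
        calc _ = 576 * (((R / N) ^ (1 - s)) ^ 4 * ((R⁻¹) ^ 2 * (R ^ δ) ^ 2)) * T := by ring
          _ = _ := by rw [e1, e2, e3, ← e4]; ring
    -- The exponent 2 - 4s + 2δ is nonpositive exactly because δ ≤ 2s - 1.
    _ ≤ 576 * (1 * N ^ (-2 + 2 * δ)) * T := by
        gcongr
        exact Real.rpow_le_one_of_one_le_of_nonpos ((one_le_div₀ hN0).2 hi.le) (by linarith)
    _ = _ := by rw [one_mul]

/-! ### The multilinear estimate -/

lemma lintegral_weightedHat_alternating_sq {ρ : ℝ → ℝ}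
    (hρ : (fun x : Plane => ρ ‖x‖).HasTemperateGrowth) (u : 𝓢(Plane, ℂ)) {k : ℕ} (j : Fin k) :
    ∫⁻ ξ, ENNReal.ofReal (weightedHat ρ (alternating u j) ξ) ^ 2 =
      ENNReal.ofReal (sobolevNorm 1 (multiplierOp ρ u)) ^ 2 := by
  rw [← lintegral_weightedHat_sq hρ, alternating]
  split_ifs
  · rfl
  · rw [← lintegral_neg_eq_self (fun ξ => ENNReal.ofReal (weightedHat ρ u ξ) ^ 2)]
    simp only [weightedHat, hat_conj, norm_neg, RCLike.norm_conj]

/-- The integrand controlling the region where the frequencies `i` and `k` dominate. -/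
noncomputable def pairMajorant (δ : ℝ) (ρ : ℝ → ℝ) (u : Plane → ℂ) (i k : Fin 4)
    (ξ : Fin 4 → Plane) : ℝ≥0∞ :=
  ∏ j, if j = i ∨ j = k then ENNReal.ofReal (weightedHat ρ (alternating u j) (ξ j))
    else ENNReal.ofReal (bracketWeight δ (ξ j)) *
      ENNReal.ofReal (weightedHat ρ (alternating u j) (ξ j))

lemma lintegral_pairMajorant_le (δ : ℝ) {ρ : ℝ → ℝ} (hρc : Continuous ρ)
    (hρ : (fun x : Plane => ρ ‖x‖).HasTemperateGrowth) (u : 𝓢(Plane, ℂ)) {i k : Fin 4}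
    (hik : k ≠ i) :
    ∫⁻ ξ, pairMajorant δ ρ u i k ξ ∂(sigmaMeasure 3) ≤
      (∫⁻ x, ENNReal.ofReal (bracketWeight δ x) ^ 2) *
        ENNReal.ofReal (sobolevNorm 1 (multiplierOp ρ u)) ^ 4 := by
  set A := ENNReal.ofReal (sobolevNorm 1 (multiplierOp ρ u))
  set H := ∫⁻ x, ENNReal.ofReal (bracketWeight δ x) ^ 2
  have hw : ∀ j : Fin 4, Measurable fun x =>
      ENNReal.ofReal (weightedHat ρ (alternating u j) x) := fun j => by
    have hc := continuous_hat_alternating u j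
    unfold weightedHat
    exact (Continuous.measurable (by fun_prop)).ennreal_ofReal
  have hb : Measurable fun x => ENNReal.ofReal (bracketWeight δ x) :=
    (measurable_bracketWeight δ).ennreal_ofReal
  have hA : ∀ j : Fin 4, ∫⁻ x, ENNReal.ofReal (weightedHat ρ (alternating u j) x) ^ 2 ≤ A ^ 2 :=
    fun j => (lintegral_weightedHat_alternating_sq hρ u j).le
  have hV : ∀ j : Fin 4, ∫⁻ x, ENNReal.ofReal (bracketWeight δ x) *
      ENNReal.ofReal (weightedHat ρ (alternating u j) x) ≤ H ^ (1 / 2 : ℝ) * A := fun j => by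
    -- Cauchy–Schwarz places the weighted factor in L¹, with the weight in L².
    rw [← ENNReal.pow_le_pow_left_iff two_ne_zero, mul_pow, ← ENNReal.rpow_mul_natCast]
    refine (lintegral_mul_sq_le hb.aemeasurable (hw j).aemeasurable).trans ?_
    norm_num
    exact mul_le_mul_right (hA j) H
  refine (lintegral_sigmaMeasure_pair_le hw (fun j => hb.mul (hw j)) hA hV hik.symm).trans
    (le_of_eq ?_)
  calc H ^ (1 / 2 : ℝ) * A * (H ^ (1 / 2 : ℝ) * A) * A ^ 2 =
      (H ^ (1 / 2 : ℝ)) ^ 2 * A ^ 4 := by ring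
    _ = H * A ^ 4 := by rw [← ENNReal.rpow_mul_natCast]; norm_num

lemma IsIMultiplier.lintegral_integrand_le {s : ℝ} (hs : 1 / 2 < s) (hs1 : s < 1)
    {m : ℝ → ℝ → ℝ} (hm : IsIMultiplier s m) {δ : ℝ} (hδ : 0 < δ) (hδ1 : δ ≤ 2 * s - 1) :
    ∃ C : ℝ, 0 < C ∧ ∀ N : ℝ, 1 ≤ N → ∀ θ₀ : ℝ, 0 < θ₀ → θ₀ < 1 / 100 →
      ∀ u : 𝓢(Plane, ℂ),
        ∫⁻ ξ, ‖lambdaIntegrand (fun ξ => sigma4 (m N) ξ - sigmaTilde4 (m N) N θ₀ ξ)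
          (alternating u) ξ‖ₑ ∂(sigmaMeasure 3) ≤
          ENNReal.ofReal (C * θ₀⁻¹ * N ^ (-2 + 2 * δ) *
            sobolevNorm 1 (multiplierOp (m N) u) ^ 4) := by
  obtain ⟨C₀, hC₀, hsymb⟩ := hm.symbol_bound hs1
  set H := ∫⁻ x, ENNReal.ofReal (bracketWeight δ x) ^ 2 with hH
  have hHtop : H ≠ ⊤ := (lintegral_bracketWeight_sq_lt_top hδ).ne
  -- 16 bounds the number of ordered pairs (i, k); summing over all pairs replaces a decomposition
  -- of Σ₄. The +1 only keeps the constant positive.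
  refine ⟨C₀ * 576 * 16 * (H.toReal + 1), by positivity, fun N hN θ₀ hθ hθ1 u => ?_⟩
  set S := sobolevNorm 1 (multiplierOp (m N) u) with hS
  have hS0 : 0 ≤ S := ENNReal.toReal_nonneg
  set D := C₀ * θ₀⁻¹ * (576 * N ^ (-2 + 2 * δ)) with hD
  have hD0 : 0 ≤ D := by positivity
  have hρc : Continuous (m N) := (hm.smooth N hN).continuous
  set P : Finset (Fin 4 × Fin 4) := Finset.univ.filter fun p => p.2 ≠ p.1 with hP
  have hPcard : (P.card : ℝ≥0∞) ≤ 16 := by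
    have : P.card ≤ 16 := by decide
    exact_mod_cast this
  have hmeas : ∀ p ∈ P, Measurable (pairMajorant δ (m N) u p.1 p.2) := fun p _ => by
    unfold pairMajorant
    refine Finset.measurable_fun_prod _ fun j _ => ?_
    have hc := continuous_hat_alternating u j
    have hw : Measurable (weightedHat (m N) (alternating u j)) := by
      unfold weightedHat
      exact Continuous.measurable (by fun_prop)
    have hb := measurable_bracketWeight δ
    split_ifs <;> fun_prop
  have hpt : ∀ᵐ ξ ∂(sigmaMeasure 3),
      ‖lambdaIntegrand (fun ξ => sigma4 (m N) ξ - sigmaTilde4 (m N) N θ₀ ξ)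
          (alternating u) ξ‖ₑ ≤ ENNReal.ofReal D * ∑ p ∈ P, pairMajorant δ (m N) u p.1 p.2 ξ := by
    filter_upwards [ae_mem_sigmaSet 3, ae_alpha4_ne_zero] with ξ hξ hα
    by_cases hj : ∀ j, ‖ξ j‖ ≤ N
    · rw [lambdaIntegrand, hm.symbol_eq_zero hN θ₀ hξ hj hα]
      simp
    push Not at hj
    obtain ⟨i, hi⟩ := Finite.exists_max fun j => ‖ξ j‖
    have hiN : N < ‖ξ i‖ := by
      obtain ⟨j, hj⟩ := hj
      exact hj.trans_le (hi j)
    obtain ⟨k, hki, hk⟩ := exists_ne_norm_le_three_mul hξ i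
    have hprod := hm.prod_norm_hat_le hs hs1 hδ hδ1 hN (alternating u) hki hi hk hiN
    have hM := hsymb N hN θ₀ hθ hθ1 ξ hξ hj
    set T := ∏ j, (if j = i ∨ j = k then weightedHat (m N) (alternating u j) (ξ j)
        else bracketWeight δ (ξ j) * weightedHat (m N) (alternating u j) (ξ j)) with hT
    have hTe : ENNReal.ofReal T = pairMajorant δ (m N) u i k ξ := by
      have hW : ∀ j : Fin 4, 0 ≤ weightedHat (m N) (alternating u j) (ξ j) := fun j => by
        unfold weightedHat; positivity
      rw [hT, pairMajorant, ENNReal.ofReal_prod_of_nonneg]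
      · refine Finset.prod_congr rfl fun j _ => ?_
        split_ifs
        · rfl
        · rw [ENNReal.ofReal_mul (bracketWeight_nonneg _ _)]
      · intro j _
        split_ifs
        · exact hW j
        · exact mul_nonneg (bracketWeight_nonneg _ _) (hW j)
    calc _ ≤ ENNReal.ofReal (D * T) := by
          rw [← ofReal_norm, lambdaIntegrand, norm_mul, norm_prod]
          refine ENNReal.ofReal_le_ofReal ?_
          calc _ ≤ C₀ * θ₀⁻¹ * (576 * N ^ (-2 + 2 * δ) * T) :=
                mul_le_mul hM hprod (by positivity) (by positivity)
            _ = _ := by ring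
      _ = ENNReal.ofReal D * pairMajorant δ (m N) u i k ξ := by
          rw [ENNReal.ofReal_mul hD0, hTe]
      _ ≤ _ := by
          refine mul_le_mul_right ?_ _
          exact Finset.single_le_sum (f := fun p : Fin 4 × Fin 4 =>
            pairMajorant δ (m N) u p.1 p.2 ξ) (fun _ _ => zero_le)
            (Finset.mem_filter.2 ⟨Finset.mem_univ (i, k), hki⟩)
  calc _ ≤ ∫⁻ ξ, ENNReal.ofReal D * ∑ p ∈ P, pairMajorant δ (m N) u p.1 p.2 ξ ∂(sigmaMeasure 3) :=
        lintegral_mono_ae hpt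
    _ = ENNReal.ofReal D * ∑ p ∈ P, ∫⁻ ξ, pairMajorant δ (m N) u p.1 p.2 ξ ∂(sigmaMeasure 3) := by
        rw [lintegral_const_mul _ (Finset.measurable_fun_sum _ hmeas), lintegral_finsetSum _ hmeas]
    _ ≤ ENNReal.ofReal D * ∑ p ∈ P, H * ENNReal.ofReal S ^ 4 := by
        gcongr with p hp
        exact lintegral_pairMajorant_le δ hρc (hm.hasTemperateGrowth hs1 hN) u
          (Finset.mem_filter.1 hp).2
    _ ≤ ENNReal.ofReal D * (16 * (H * ENNReal.ofReal S ^ 4)) := by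
        rw [Finset.sum_const, nsmul_eq_mul]
        gcongr
    _ = ENNReal.ofReal (D * (16 * (H.toReal * S ^ 4))) := by
        rw [ENNReal.ofReal_mul (p := D) hD0, ENNReal.ofReal_mul (p := 16) (by norm_num),
          ENNReal.ofReal_mul ENNReal.toReal_nonneg, ENNReal.ofReal_toReal hHtop,
          ENNReal.ofReal_pow hS0]
        norm_num
    _ ≤ _ := by
        refine ENNReal.ofReal_le_ofReal ?_
        have : D * (16 * (H.toReal * S ^ 4)) ≤ D * (16 * ((H.toReal + 1) * S ^ 4)) := by
          gcongr
          linarith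
        refine this.trans (le_of_eq ?_)
        rw [hD]
        ring

end IMethod

theorem mainTheorem7 (s : ℝ) (hs : 1 / 2 < s) (hs1 : s < 1)
    (m : ℝ → ℝ → ℝ) (hm : IMethod.IsIMultiplier s m) (ε : ℝ) (hε : 0 < ε) :
    ∃ C : ℝ, 0 < C ∧ ∀ N : ℝ, 1 ≤ N → ∀ θ₀ : ℝ, 0 < θ₀ → θ₀ < 1 / 100 →
      ∀ u : SchwartzMap IMethod.Plane ℂ,
        MeasureTheory.Integrable
          (IMethod.lambdaIntegrand
            (fun ξ => IMethod.sigma4 (m N) ξ - IMethod.sigmaTilde4 (m N) N θ₀ ξ)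
            (IMethod.alternating u))
          (IMethod.sigmaMeasure 3) ∧
        |IMethod.Lambda (n := 3)
            (fun ξ => IMethod.sigma4 (m N) ξ - IMethod.sigmaTilde4 (m N) N θ₀ ξ)
            (IMethod.alternating u)| ≤
          C * θ₀⁻¹ * N ^ (-2 + ε) *
            IMethod.sobolevNorm 1 (IMethod.multiplierOp (m N) u) ^ 4 := by
  -- δ ≤ ε/2 turns the loss N^{2δ} into N^ε; δ ≤ 2s - 1 keeps the sum over large R/N under control.
  obtain ⟨C, hC, hbound⟩ := hm.lintegral_integrand_le hs hs1 (δ := min (ε / 2) (2 * s - 1))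
    (lt_min (by linarith) (by linarith)) (min_le_right _ _)
  refine ⟨C, hC, fun N hN θ₀ hθ hθ1 u => ?_⟩
  have hle := hbound N hN θ₀ hθ hθ1 u
  have hS0 : 0 ≤ IMethod.sobolevNorm 1 (IMethod.multiplierOp (m N) u) := ENNReal.toReal_nonneg
  refine ⟨⟨IMethod.aestronglyMeasurable_integrand (hm.smooth N hN).continuous N θ₀ u,
    hle.trans_lt ENNReal.ofReal_lt_top⟩, ?_⟩
  set J := ∫ ξ, IMethod.lambdaIntegrand
    (fun ξ => IMethod.sigma4 (m N) ξ - IMethod.sigmaTilde4 (m N) N θ₀ ξ)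
    (IMethod.alternating u) ξ ∂(IMethod.sigmaMeasure 3) with hJ
  have hJle : ‖J‖ ≤ C * θ₀⁻¹ * N ^ (-2 + 2 * min (ε / 2) (2 * s - 1)) *
      IMethod.sobolevNorm 1 (IMethod.multiplierOp (m N) u) ^ 4 := by
    rw [← ENNReal.ofReal_le_ofReal_iff (by positivity), ofReal_norm]
    exact (MeasureTheory.enorm_integral_le_lintegral_enorm _).trans hle
  have hpi : 1 / (2 * Real.pi) ^ (2 * 3) ≤ 1 := by
    refine div_le_one_of_le₀ (one_le_pow₀ ?_) (by positivity)
    linarith [Real.pi_gt_three]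
  calc |IMethod.Lambda (n := 3) _ _| = 1 / (2 * Real.pi) ^ (2 * 3) * |J.re| := by
        rw [IMethod.Lambda, abs_mul, abs_of_nonneg (by positivity)]
    _ ≤ 1 * ‖J‖ := mul_le_mul hpi (Complex.abs_re_le_norm J) (abs_nonneg _) zero_le_one
    _ ≤ _ := by
        rw [one_mul]
        refine hJle.trans ?_
        gcongr
        linarith [min_le_left (ε / 2) (2 * s - 1)]
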